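/- **Setting.** A (non-reduced) NAE-$K$-SAT instance consists of finitely many clauses on Boolean variables $x_1,\dots,x_n$, each clause being a set of $K$ literals on distinct variables. An assignment satisfies it if every clause contains at least one literal of value $1$ and at least one literal of value $0$. The random instance $\Phi(n,dn)$ has $\lfloor dn\rfloor$ independent clauses; the $K$ variables of each clause are chosen uniformly without replacement from $x_1,\dots,x_n$, and each is negated independently with probability $1/2$. A *reduced clause* is a set of at most $K$ literals on distinct variables with a sign in $\{+,-,0\}$, the sign being $0$ if and only if the clause has exactly $K$ literals; sign $+$ requires some literal of the clause to take value $0$, sign $-$ requires some literal to take value $1$, and sign $0$ requires both. A (reduced or non-reduced) instance is a finite collection of such clauses; a non-reduced one has only signs $0$. Its *complement* $\bar\Psi$ is obtained by exchanging the signs $+$ and $-$. Its *factor graph* is the bipartite graph joining each clause to the variables that appear in it. For an even $r$, let $B_\Psi(x,r)$ be the instance formed by the clauses of $\Psi$ at distance at most $r$ from the variable $x$ in the factor graph, rooted at $x$. Let $\mathcal{SAT}_r$ be the set of instances $\Psi$ with a root variable $x$ such that all variables of $\Psi$ are at distance at most $r$ from $x$ in the factor graph of $\Psi$ (the instance without clauses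 is included). A *local rule* is a function $\tau:\mathcal{SAT}_r\to[0,1]$; it is *balanced* if $\tau(\bar\Psi)=1-\tau(\Psi)$ for all $\Psi\in\mathcal{SAT}_r$, the complement keeping the root. The *$\tau$-sequential local algorithm* on input $\Phi$ sets $\Phi_0=\Phi$ and, for $i=1,\dots,n$, sets $\sigma(x_i)=1$ with probability $\tau(B_{\Phi_{i-1}}(x_i,r))$ and $\sigma(x_i)=0$ otherwise, using fresh randomness independent of $\Phi$. It then obtains $\Phi_i$ from $\Phi_{i-1}$ by fixing this value: clauses that become satisfied or violated are removed, and every other clause containing $x_i$ loses its literal on $x_i$ and gets the sign $+$ if that literal has value $1$ and $-$ if it has value $0$. The output is $\sigma_{\Phi,\tau}=(\sigma(x_1),\dots,\sigma(x_n))$. **Theorem.** For every $\varepsilon>0$ there is $K_0$ such that for every integer $K\ge K_0$, every real $d>(1+\varepsilon)\,2^{K-1}\ln^2K/K$, every even $r>0$ and every balanced local rule $\tau:\mathcal{SAT}_r\to[0,1]$, $$\lim_{n\to\infty}\mathbb P\bigl(\sigma_{\Phi(n,dn),\tau}\text{ satisfies }\Phi(n,dn)\bigr)=0 .$$ -/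

import Mathlib

open MeasureTheory ProbabilityTheory

namespace NAESAT

/-! ### Formulas -/

/-- A clause on the variables indexed by `Fin n`: a choice of `K` distinct variables, and for each
of them a flag telling whether it is negated (`true` means that the variable appears negated). -/
def Clause (K n : ℕ) : Type := (Fin K ↪ Fin n) × (Fin K → Bool)

noncomputable instance (K n : ℕ) : Fintype (Clause K n) :=
  inferInstanceAs (Fintype ((Fin K ↪ Fin n) × (Fin K → Bool)))

instance (K n : ℕ) : MeasurableSpace (Clause K n) := ⊤

/-- A (non-reduced) instance with `m` clauses `C₁, …, C_m` on `n` variables. -/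
abbrev Formula (K n m : ℕ) : Type := Fin m → Clause K n

/-- The value under `σ` of the `k`-th literal of a clause. -/
def Clause.litValue {K n : ℕ} (C : Clause K n) (σ : Fin n → Bool) (k : Fin K) : Bool :=
  xor (σ (C.1 k)) (C.2 k)

/-- In every clause at least one literal has value `1` and at least one has value `0`. -/
def Formula.IsSatisfiedBy {K n m : ℕ} (Φ : Formula K n m) (σ : Fin n → Bool) : Prop :=
  ∀ j, (∃ k, (Φ j).litValue σ k = true) ∧ (∃ k, (Φ j).litValue σ k = false)

/-- The random instance: `m` independent clauses, each one a uniformly random choice of `K`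
distinct variables out of `n` together with independent fair negation flags.
(If `n < K` no clause exists and the measure is `0` as soon as `0 < m`.) -/
noncomputable def randomFormula (K n m : ℕ) : Measure (Formula K n m) :=
  Measure.pi fun _ => uniformOn (Set.univ : Set (Clause K n))

/-! ### Reduced instances -/

/-- The literal `(v, neg)` is the variable `v`, negated if `neg = true`. Variable labels are
natural numbers, so that one local rule can be run on instances with any number of variables. -/
abbrev Literal : Type := ℕ × Bool

/-- A reduced clause: a set of at most `K` literals on distinct variables with a sign in
`{+, -, 0}`; the sign is `0` exactly for the clauses with `K` literals.
A clause with sign `+` still needs a literal of value `0`, a clause with sign `-` still needs a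
literal of value `1`, and a clause with sign `0` needs both. -/
@[ext] structure ReducedClause (K : ℕ) where
  lits : Finset Literal
  sign : SignType
  injOn : Set.InjOn Prod.fst (lits : Set Literal)
  card_le : lits.card ≤ K
  card_eq_iff : lits.card = K ↔ sign = 0

/-- The variable `v` appears in the clause `C`. -/
def ReducedClause.Mentions {K : ℕ} (C : ReducedClause K) (v : ℕ) : Prop :=
  ∃ ℓ ∈ C.lits, ℓ.1 = v

/-- The complement of a clause: same literals, opposite sign. -/
def ReducedClause.compl {K : ℕ} (C : ReducedClause K) : ReducedClause K where
  lits := C.lits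
  sign := -C.sign
  injOn := C.injOn
  card_le := C.card_le
  card_eq_iff := by
    rw [C.card_eq_iff]
    cases C.sign <;> decide

/-- A reduced or non-reduced instance: a finite collection of reduced clauses, with repetitions
allowed. -/
abbrev Instance (K : ℕ) : Type := Multiset (ReducedClause K)

/-- The complement of an instance. -/
def Instance.compl {K : ℕ} (Ψ : Instance K) : Instance K := Ψ.map ReducedClause.compl

/-- The non-reduced clause of sign `0` given by a `K`-clause. -/
def Clause.toReduced {K n : ℕ} (C : Clause K n) : ReducedClause K where
  lits := Finset.univ.image fun k : Fin K => ((C.1 k : ℕ), C.2 k)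
  sign := 0
  injOn := by
    intro a ha b hb hab
    simp only [Finset.coe_image, Finset.coe_univ, Set.image_univ, Set.mem_range] at ha hb
    obtain ⟨i, rfl⟩ := ha
    obtain ⟨j, rfl⟩ := hb
    have hij : i = j := C.1.injective (Fin.ext hab)
    rw [hij]
  card_le := Finset.card_image_le.trans (by simp)
  card_eq_iff := by
    rw [Finset.card_image_of_injective _ (fun i j h => C.1.injective (Fin.ext (Prod.ext_iff.1 h).1))]
    simp

/-- The instance given by a formula. -/
def Formula.toInstance {K n m : ℕ} (Φ : Formula K n m) : Instance K :=
  Finset.univ.val.map fun j => (Φ j).toReduced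

open Classical in
/-- The effect on the clause `C` of giving the value `b` to the variable `v`. A clause that does not
contain `v` is kept. Otherwise the literal on `v` takes some value; let `s` be `+` if that value
is `1` and `-` if it is `0`. The clause becomes satisfied, and is removed, if it already had
the sign opposite to `s`; it becomes violated, and is removed, if it is not satisfied and no literal
is left; else it is kept without the literal on `v` and with sign `s`. -/
noncomputable def ReducedClause.assign {K : ℕ} (v : ℕ) (b : Bool) (C : ReducedClause K) :
    Option (ReducedClause K) :=
  if h : C.Mentions v then
    let rest : Finset Literal := C.lits.filter fun ℓ => ℓ.1 ≠ v
    let s : SignType := if (v, !b) ∈ C.lits then 1 else -1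
    if C.sign = -s ∨ rest = ∅ then none
    else some
      { lits := rest
        sign := s
        injOn := C.injOn.mono (by exact_mod_cast Finset.filter_subset _ _)
        card_le := (Finset.card_filter_le _ _).trans C.card_le
        card_eq_iff := by
          obtain ⟨ℓ, hℓ, hv⟩ := h
          have hlt : rest.card < C.lits.card :=
            Finset.card_lt_card (Finset.filter_ssubset.2 ⟨ℓ, hℓ, by simpa using hv⟩)
          have hs : s ≠ 0 := by
            simp only [s]
            split_ifs <;> decide
          have := C.card_le
          exact ⟨fun h => absurd h (by omega), fun h => absurd h hs⟩ }
  else some C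

/-- The instance obtained by giving the value `b` to the variable `v`. -/
noncomputable def Instance.assign {K : ℕ} (v : ℕ) (b : Bool) (Ψ : Instance K) : Instance K :=
  Ψ.filterMap (ReducedClause.assign v b)

/-! ### The factor graph and local neighbourhoods -/

/-- The factor graph: a bipartite graph joining each clause of `Ψ` to the variables that appear in
it. Equal clauses of `Ψ` share one vertex here, which does not change any distance; multiplicities
are kept by the multiset `Ψ`. -/
def factorGraph {K : ℕ} (Ψ : Instance K) : SimpleGraph (ℕ ⊕ ReducedClause K) where
  Adj
    | .inl v, .inr C => C ∈ Ψ ∧ C.Mentions v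
    | .inr C, .inl v => C ∈ Ψ ∧ C.Mentions v
    | _, _ => False
  symm := ⟨by rintro (v | C) (w | D) h <;> exact h⟩
  loopless := ⟨by rintro (v | C) h <;> exact h⟩

open Classical in
/-- The depth-`r` neighbourhood of the variable `x`, as an instance: the clauses of `Ψ` at distance
at most `r` from `x` in the factor graph. -/
noncomputable def ball {K : ℕ} (Ψ : Instance K) (x r : ℕ) : Instance K :=
  Ψ.filter fun C => (factorGraph Ψ).edist (.inl x) (.inr C) ≤ r

/-- The rooted instances of depth at most `r`: every variable is at distance at most `r` from the
root in the factor graph. The variables of the instance are the root (which may be in no clause)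
and the variables that appear in its clauses. -/
@[ext] structure RootedInstance (K r : ℕ) where
  inst : Instance K
  root : ℕ
  edist_le : ∀ C ∈ inst, ∀ v, C.Mentions v →
    (factorGraph inst).edist (.inl root) (.inl v) ≤ r

theorem exists_walk_of_edist_le {V : Type*} {G : SimpleGraph V} {a b : V} {r : ℕ}
    (h : G.edist a b ≤ r) : ∃ p : G.Walk a b, p.length ≤ r := by
  obtain ⟨p, hp⟩ := G.exists_walk_of_edist_ne_top (ne_top_of_le_ne_top (by simp) h)
  exact ⟨p, by rw [← hp] at h; exact_mod_cast h⟩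

theorem odd_length {K : ℕ} {Ψ : Instance K} {x : ℕ} {C : ReducedClause K}
    (p : (factorGraph Ψ).Walk (.inl x) (.inr C)) : Odd p.length := by
  let c : (factorGraph Ψ).Coloring Bool := SimpleGraph.Coloring.mk Sum.isLeft (by
    rintro (v | C) (w | D) h <;> first | exact h.elim | simp)
  rw [c.odd_length_iff_not_congr]
  have h₁ : c (.inl x) = true := rfl
  have h₂ : c (.inr C) = false := rfl
  simp [h₁, h₂]

theorem ball_edist_le {K : ℕ} (Ψ : Instance K) (x r : ℕ) (hr : Even r) :
    ∀ C ∈ ball Ψ x r, ∀ v, C.Mentions v →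
      (factorGraph (ball Ψ x r)).edist (.inl x) (.inl v) ≤ r := by
  classical
  intro C hC v hv
  obtain ⟨p, hp⟩ := exists_walk_of_edist_le (Multiset.mem_filter.1 hC).2
  have hball : ∀ D : ReducedClause K, D ∈ Ψ → .inr D ∈ p.support → D ∈ ball Ψ x r := by
    intro D hD hs
    refine Multiset.mem_filter.2 ⟨hD, ((p.takeUntil _ hs).edist_le).trans ?_⟩
    exact_mod_cast (p.length_takeUntil_le_length hs).trans hp
  have hedge : ∀ e ∈ p.edges, e ∈ (factorGraph (ball Ψ x r)).edgeSet := by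
    intro e he
    have hadj := p.edges_subset_edgeSet he
    induction e with
    | _ a b =>
      have ha := p.fst_mem_support_of_mem_edges he
      have hb := p.snd_mem_support_of_mem_edges he
      rcases a with a | D <;> rcases b with b | E
      · exact hadj
      · exact ⟨hball E hadj.1 hb, hadj.2⟩
      · exact ⟨hball D hadj.1 ha, hadj.2⟩
      · exact hadj
  have hlast : (factorGraph (ball Ψ x r)).Adj (.inr C) (.inl v) := ⟨hC, hv⟩
  have hodd := odd_length p
  have hlt : p.length + 1 ≤ r := by
    rcases hp.lt_or_eq with h | h
    · exact h
    · rw [h] at hodd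
      exact absurd hr (Nat.not_even_iff_odd.2 hodd)
  refine (((p.transfer _ hedge).concat hlast).edist_le).trans ?_
  rw [SimpleGraph.Walk.length_concat, SimpleGraph.Walk.length_transfer]
  exact_mod_cast hlt

/-- The depth-`r` neighbourhood of `x` in `Ψ`, rooted at `x`. -/
noncomputable def nbhd {K r : ℕ} (hr : Even r) (Ψ : Instance K) (x : ℕ) : RootedInstance K r where
  inst := ball Ψ x r
  root := x
  edist_le := ball_edist_le Ψ x r hr

/-- The complement of a rooted instance. -/
def RootedInstance.compl {K r : ℕ} (Ψ : RootedInstance K r) : RootedInstance K r where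
  inst := Ψ.inst.compl
  root := Ψ.root
  edist_le := by
    intro C hC v hv
    obtain ⟨D, hD, rfl⟩ := Multiset.mem_map.1 hC
    obtain ⟨p, hp⟩ := exists_walk_of_edist_le (Ψ.edist_le D hD v hv)
    let f : factorGraph Ψ.inst →g factorGraph Ψ.inst.compl :=
      { toFun := Sum.map id ReducedClause.compl
        map_rel' := by
          rintro (a | E) (b | F) h
          · exact h
          · exact ⟨Multiset.mem_map_of_mem _ h.1, h.2⟩
          · exact ⟨Multiset.mem_map_of_mem _ h.1, h.2⟩
          · exact h }
    refine (p.map f).edist_le.trans ?_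
    rw [SimpleGraph.Walk.length_map]
    exact_mod_cast hp

/-! ### Sequential local algorithms -/

/-- A local rule: the probability of setting the root to `1`, given a rooted instance. -/
abbrev LocalRule (K r : ℕ) : Type := RootedInstance K r → unitInterval

/-- Complementing the instance exchanges the probabilities of the values `1` and `0`. -/
def LocalRule.IsBalanced {K r : ℕ} (τ : LocalRule K r) : Prop :=
  ∀ Ψ : RootedInstance K r, (τ Ψ.compl : ℝ) = 1 - (τ Ψ : ℝ)

/-- The value given to the variable `x` when the current instance is `Ψ` and the random seed is `t`.
For `t` uniform in `[0, 1]` it is `1` with probability `τ (nbhd hr Ψ x)`. -/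
noncomputable def decision {K r : ℕ} (hr : Even r) (τ : LocalRule K r) (Ψ : Instance K)
    (x : ℕ) (t : unitInterval) : Bool :=
  decide (t < τ (nbhd hr Ψ x))

/-- The instance `Φ_i` that is left after the first `i` variables have been set, when the `j`-th
decision uses the seed `u j`. -/
noncomputable def residual {K r n : ℕ} (hr : Even r) (τ : LocalRule K r) (Φ : Instance K)
    (u : Fin n → unitInterval) : ℕ → Instance K
  | 0 => Φ
  | i + 1 =>
    if h : i < n then
      (residual hr τ Φ u i).assign i (decision hr τ (residual hr τ Φ u i) i (u ⟨i, h⟩))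
    else residual hr τ Φ u i

/-- The assignment that the sequential local algorithm outputs with the seeds `u`. -/
noncomputable def output {K r n : ℕ} (hr : Even r) (τ : LocalRule K r) (Φ : Instance K)
    (u : Fin n → unitInterval) (i : Fin n) : Bool :=
  decision hr τ (residual hr τ Φ u i) i (u i)

/-- The probability that the sequential local algorithm with rule `τ`, using independent seeds that
are uniform in `[0, 1]` and independent of the formula, outputs a satisfying assignment of the
random formula with `n` variables and `m` clauses. -/
noncomputable def successProb {K r : ℕ} (hr : Even r) (τ : LocalRule K r) (n m : ℕ) : ENNReal :=
  ((randomFormula K n m).prod (volume : Measure (Fin n → unitInterval)))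
    {ω | Formula.IsSatisfiedBy ω.1 (output hr τ (Formula.toInstance ω.1) ω.2)}

end NAESAT

/-!
# Failure of sequential local algorithms for random NAE-`K`-SAT

The proof is an overlap gap argument for tuples of assignments. Call two variables linked if they
are at most `r` steps apart in the formula, a step joining two variables of one clause. Say that `i`
influences `j` if there is a chain `i = j₀ < j₁ < ⋯ < j_l = j` of consecutively linked variables.

*Locality.* For a fixed formula the value that the algorithm gives to `j` depends only on the seeds
of the variables that influence `j` (`output_congr`). A random formula has on average `o(n²)` pairs
of variables with a common influence (`exists_expect_card_correlatedPairs_le`). Indeed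
neighbourhood sizes have bounded exponential moments (`expect_exp_card_hull_le`), and by the
symmetry between the variables a sequence of `l + 1` linked variables is increasing with probability
`1 / (l + 1)!` only (`factorial_mul_expect_card_strictMono_le`). So chains of influence are
short, and what influences a typical variable lies within a bounded distance of it.

*Interpolation.* Run the algorithm `q` times on one formula. At stage `t` the runs use private seeds
for the first `t` variables and common seeds for the others. At stage `0` all outputs coincide. At
stage `n` two of them differ on `n / 2` variables on average, because reversing all the seeds of a
balanced rule complements the output (`output_symm`). One stage moves the mean distance by `o(n)`
only, and distances concentrate by Chebyshev's inequality, as decisions on variables without common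
influence are independent. Hence at some stage all pairwise distances lie close to any prescribed
value. Given the common seeds the runs are independent, so that by Jensen's inequality they all
satisfy the formula with probability at least the `q`-th power of the success probability
(`pow_volume_le_of_no_tuple`).

*First moment.* For `q` of order `K / log² K`, a random formula has with high probability no `q`
satisfying assignments whose pairwise distances all lie between `(log K / K) n` and
`((log K + 1) / K) n` (`expect_exists_tuple_le`, `exists_parameters`). At these distances the events
that a clause is violated by the different assignments are nearly disjoint, so that the cost of
satisfying all clauses is about `q` times that of a single assignment, whereas only the first
assignment has full entropy.
-/

namespace NAESAT

open Finset
open scoped BigOperators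

/-! ### Averages over finite product spaces -/

section Averages

variable {ι X : Type*} [Fintype ι] [DecidableEq ι] [Fintype X]

/-- If `F f g` depends on `f` only through its restriction to `B` and on `g` only through its
restriction to the complement of `B`, then the two restrictions of one uniformly random function
may be replaced by those of two independent ones. -/
theorem expect_diag_eq_expect_expect [Nonempty X] (B : Finset ι) (F : (ι → X) → (ι → X) → ℝ)
    (h₁ : ∀ f f' g, (∀ i ∈ B, f i = f' i) → F f g = F f' g)
    (h₂ : ∀ f g g', (∀ i ∉ B, g i = g' i) → F f g = F f g') :
    𝔼 f, F f f = 𝔼 f, 𝔼 g, F f g := by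
  have hF : ∀ f g, F f g = F (B.piecewise f g) (B.piecewise f g) := by
    intro f g
    rw [h₁ (B.piecewise f g) f _ (fun i hi => by simp [hi]),
      h₂ f (B.piecewise f g) g (fun i hi => by simp [hi])]
  -- Exchanging the coordinates in `B` is an involution of the pairs `(f, g)`.
  let e : (ι → X) × (ι → X) ≃ (ι → X) × (ι → X) :=
    { toFun := fun p => (B.piecewise p.1 p.2, B.piecewise p.2 p.1)
      invFun := fun p => (B.piecewise p.1 p.2, B.piecewise p.2 p.1)
      left_inv := fun p => by ext i <;> by_cases hi : i ∈ B <;> simp [hi]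
      right_inv := fun p => by ext i <;> by_cases hi : i ∈ B <;> simp [hi] }
  have hswap : 𝔼 p : (ι → X) × (ι → X), F p.1 p.2 = 𝔼 p : (ι → X) × (ι → X), F p.1 p.1 :=
    Fintype.expect_equiv e _ _ fun p => hF p.1 p.2
  have huniv : (univ : Finset ((ι → X) × (ι → X))) = univ ×ˢ univ := rfl
  rw [huniv, expect_product, expect_product] at hswap
  rw [hswap]
  simp only [Fintype.expect_const]

theorem expect_prod_eq_prod_expect [Nonempty X] (B : Finset ι) (h : X → ℝ) :
    𝔼 f : ι → X, ∏ i ∈ B, h (f i) = (𝔼 x, h x) ^ #B := by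
  have hsum : ∑ f : ι → X, ∏ i ∈ B, h (f i)
      = (∑ x, h x) ^ #B * (Fintype.card X : ℝ) ^ (Fintype.card ι - #B) := by
    have h₁ : ∀ f : ι → X, ∏ i ∈ B, h (f i) = ∏ i, if i ∈ B then h (f i) else 1 := by
      intro f
      simp [Finset.prod_ite_mem]
    simp_rw [h₁]
    rw [← Fintype.prod_sum (fun i x => if i ∈ B then h x else (1 : ℝ))]
    have h₂ : ∀ i, (∑ x, if i ∈ B then h x else (1 : ℝ))
        = if i ∈ B then ∑ x, h x else (Fintype.card X : ℝ) := by
      intro i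
      split_ifs <;> simp
    simp_rw [h₂]
    rw [Finset.prod_ite]
    simp only [Finset.prod_const]
    congr 2
    · simp
    · rw [← Finset.card_compl]
      congr 1
      ext i
      simp
  have hX : (Fintype.card X : ℝ) ≠ 0 := by exact_mod_cast Fintype.card_ne_zero
  rw [Fintype.expect_eq_sum_div_card, Fintype.expect_eq_sum_div_card, hsum, Fintype.card_fun,
    div_pow]
  have : Fintype.card ι = #B + (Fintype.card ι - #B) := by
    have := Finset.card_le_univ B
    omega
  push_cast
  rw [div_eq_div_iff (by positivity) (by positivity)]
  conv_rhs => rw [this, pow_add]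
  ring

end Averages

variable {K n m r q : ℕ}

/-! ### Neighbourhoods in random formulas -/

/-- The set of variables of a clause. -/
def Clause.vars (C : Clause K n) : Finset (Fin n) := univ.map C.1

theorem Clause.mem_vars {C : Clause K n} {v : Fin n} : v ∈ C.vars ↔ ∃ k, C.1 k = v := by
  simp [Clause.vars]

theorem Clause.card_vars (C : Clause K n) : #C.vars = K := by
  simp [Clause.vars]

/-- `Reach Φ I k u v`: one can go from the variable `u` to the variable `v` in at most `k` steps,
each step joining two variables of one clause `Φ a` with `a ∈ I`. -/
def Reach (Φ : Formula K n m) (I : Finset (Fin m)) : ℕ → Fin n → Fin n → Prop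
  | 0, u, v => u = v
  | k + 1, u, v => ∃ w, (u = w ∨ ∃ a ∈ I, u ∈ (Φ a).vars ∧ w ∈ (Φ a).vars) ∧ Reach Φ I k w v

section Reach

variable {Φ : Formula K n m} {I : Finset (Fin m)} {k l : ℕ} {u v w : Fin n}

theorem Reach.refl (k : ℕ) (u : Fin n) : Reach Φ I k u u := by
  induction k with
  | zero => rfl
  | succ k ih => exact ⟨u, Or.inl rfl, ih⟩

theorem Reach.of_mem_clause {a : Fin m} (ha : a ∈ I) (hu : u ∈ (Φ a).vars)
    (hv : v ∈ (Φ a).vars) : Reach Φ I 1 u v :=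
  ⟨v, Or.inr ⟨a, ha, hu, hv⟩, rfl⟩

theorem Reach.trans (h₁ : Reach Φ I k u v) (h₂ : Reach Φ I l v w) : Reach Φ I (k + l) u w := by
  induction k generalizing u with
  | zero => rw [Nat.zero_add]; cases h₁; exact h₂
  | succ k ih =>
    obtain ⟨x, hx, h⟩ := h₁
    rw [Nat.succ_add]
    exact ⟨x, hx, ih h⟩

theorem Reach.symm (h : Reach Φ I k u v) : Reach Φ I k v u := by
  induction k generalizing u with
  | zero => exact Eq.symm h
  | succ k ih =>
    obtain ⟨x, hx, h⟩ := h
    refine (ih h).trans (l := 1) ⟨u, ?_, rfl⟩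
    rcases hx with rfl | ⟨a, ha, hu, hx⟩
    · exact Or.inl rfl
    · exact Or.inr ⟨a, ha, hx, hu⟩

theorem Reach.mono (hkl : k ≤ l) (h : Reach Φ I k u v) : Reach Φ I l u v := by
  obtain ⟨j, rfl⟩ := Nat.exists_eq_add_of_le hkl
  exact h.trans (Reach.refl j v)

theorem Reach.congr {Φ' : Formula K n m} (h : ∀ a ∈ I, Φ a = Φ' a) :
    Reach Φ I k u v ↔ Reach Φ' I k u v := by
  induction k generalizing u with
  | zero => rfl
  | succ k ih =>
    simp only [Reach, ih]
    refine exists_congr fun w => and_congr_left fun _ => or_congr_right ?_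
    refine exists_congr fun a => and_congr_right fun ha => ?_
    rw [h a ha]

end Reach

open Classical in
/-- The set of variables that can be reached in `k` steps from the set `S`, using the clauses with
index in `I` only. -/
noncomputable def hull (Φ : Formula K n m) (I : Finset (Fin m)) (k : ℕ) (S : Finset (Fin n)) :
    Finset (Fin n) :=
  {v | ∃ u ∈ S, Reach Φ I k u v}

theorem mem_hull {Φ : Formula K n m} {I : Finset (Fin m)} {k : ℕ} {S : Finset (Fin n)}
    {v : Fin n} : v ∈ hull Φ I k S ↔ ∃ u ∈ S, Reach Φ I k u v := by
  simp [hull]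

theorem hull_zero (Φ : Formula K n m) (I : Finset (Fin m)) (S : Finset (Fin n)) :
    hull Φ I 0 S = S := by
  ext v
  simp [mem_hull, Reach]

open Classical in
/-- The indices in `I` of the clauses that meet `S`. -/
noncomputable def touching (Φ : Formula K n m) (I : Finset (Fin m)) (S : Finset (Fin n)) :
    Finset (Fin m) :=
  {a ∈ I | ∃ v ∈ S, v ∈ (Φ a).vars}

/-- Once the clauses meeting `S` have been explored, they are of no further use: their variables
already belong to the starting set of the next round. -/
theorem hull_succ_subset (Φ : Formula K n m) (I : Finset (Fin m)) (k : ℕ) (S : Finset (Fin n)) :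
    hull Φ I (k + 1) S ⊆
      hull Φ (I \ touching Φ I S) k (S ∪ (touching Φ I S).biUnion fun a => (Φ a).vars) := by
  classical
  set A := touching Φ I S
  have key : ∀ (k : ℕ) (T : Finset (Fin n)), (∀ a ∈ A, (Φ a).vars ⊆ T) → ∀ u ∈ T, ∀ v,
      Reach Φ I k u v → ∃ u' ∈ T, Reach Φ (I \ A) k u' v := by
    intro k
    induction k with
    | zero => exact fun T _ u hu v h => ⟨u, hu, h⟩
    | succ k ih =>
      rintro T hT u hu v ⟨w, huw, hwv⟩
      obtain ⟨u', hu', h⟩ := ih (insert w T)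
        (fun a ha => (hT a ha).trans (subset_insert _ _)) w (mem_insert_self _ _) v hwv
      by_cases hT' : u' ∈ T
      · exact ⟨u', hT', h.mono (Nat.le_succ k)⟩
      · obtain rfl : u' = w := by simpa [hT'] using hu'
        rcases huw with rfl | ⟨a, ha, hua, hwa⟩
        · exact absurd hu hT'
        · have haA : a ∈ I \ A := mem_sdiff.2 ⟨ha, fun haA => hT' (hT a haA hwa)⟩
          exact ⟨u, hu, u', Or.inr ⟨a, haA, hua, hwa⟩, h⟩
  intro v hv
  obtain ⟨u, hu, w, huw, hwv⟩ := mem_hull.1 hv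
  refine mem_hull.2 (key k _ ?_ w ?_ v hwv)
  · exact fun a ha => (subset_biUnion_of_mem (fun a => (Φ a).vars) ha).trans subset_union_right
  · rcases huw with rfl | ⟨a, ha, hua, hwa⟩
    · exact mem_union_left _ hu
    · refine mem_union_right _ (mem_biUnion.2 ⟨a, ?_, hwa⟩)
      simp only [A, touching, mem_filter]
      exact ⟨ha, u, hu, hua⟩

theorem Clause.nonempty (h : K ≤ n) : Nonempty (Clause K n) :=
  ⟨(Fin.castLEEmb h, fun _ => false)⟩

/-- Renaming the variables of a clause. -/
def Clause.rename (π : Equiv.Perm (Fin n)) : Clause K n ≃ Clause K n where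
  toFun C := (C.1.trans π.toEmbedding, C.2)
  invFun C := (C.1.trans π.symm.toEmbedding, C.2)
  left_inv C := Prod.ext (by ext; simp) rfl
  right_inv C := Prod.ext (by ext; simp) rfl

/-- A uniformly random clause meets `S` with probability at most `K |S| / n`. -/
theorem expect_clause_meets_le (hK : K ≤ n) (S : Finset (Fin n)) :
    𝔼 C : Clause K n, Set.indicator {C : Clause K n | ∃ v ∈ S, v ∈ C.vars} (fun _ => (1 : ℝ)) C
      ≤ K * #S / n := by
  classical
  have := Clause.nonempty hK
  have hcoord : ∀ (k : Fin K) (v : Fin n), 𝔼 C : Clause K n, (if C.1 k = v then (1 : ℝ) else 0)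
      = 1 / n := by
    intro k v
    have hsymm : ∀ w, 𝔼 C : Clause K n, (if C.1 k = w then (1 : ℝ) else 0)
        = 𝔼 C : Clause K n, (if C.1 k = v then (1 : ℝ) else 0) := by
      intro w
      refine Fintype.expect_equiv (Clause.rename (Equiv.swap w v)) _ _ fun C => ?_
      have : (Clause.rename (Equiv.swap w v) C).1 k = v ↔ C.1 k = w := by
        change Equiv.swap w v (C.1 k) = v ↔ _
        rw [← Equiv.eq_symm_apply]
        simp
      simp only [this]
    have hsum : ∑ w, 𝔼 C : Clause K n, (if C.1 k = w then (1 : ℝ) else 0) = 1 := by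
      rw [← Finset.expect_sum_comm]
      simp
    simp only [hsymm, sum_const, card_univ, Fintype.card_fin, nsmul_eq_mul] at hsum
    have hn : (n : ℝ) ≠ 0 := by
      rintro h
      simp [h] at hsum
    field_simp
    linarith
  calc _ ≤ 𝔼 C : Clause K n, ∑ k : Fin K, ∑ v ∈ S, (if C.1 k = v then (1 : ℝ) else 0) := by
        refine expect_le_expect fun C _ => ?_
        by_cases h : ∃ v ∈ S, v ∈ C.vars
        · rw [Set.indicator_of_mem (by exact h)]
          obtain ⟨v, hv, hvC⟩ := h
          obtain ⟨k, hk⟩ := Clause.mem_vars.1 hvC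
          calc (1 : ℝ) = if C.1 k = v then 1 else 0 := by simp [hk]
            _ ≤ ∑ v ∈ S, (if C.1 k = v then (1 : ℝ) else 0) :=
              single_le_sum (f := fun v => if C.1 k = v then (1 : ℝ) else 0)
                (fun _ _ => by positivity) hv
            _ ≤ _ := single_le_sum (f := fun k => ∑ v ∈ S, if C.1 k = v then (1 : ℝ) else 0)
                (fun _ _ => sum_nonneg fun _ _ => by positivity) (mem_univ k)
        · rw [Set.indicator_of_notMem (by exact h)]
          exact sum_nonneg fun _ _ => sum_nonneg fun _ _ => by positivity
    _ = ∑ k : Fin K, ∑ v ∈ S, (1 / n : ℝ) := by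
        rw [expect_sum_comm]
        refine sum_congr rfl fun k _ => ?_
        rw [expect_sum_comm]
        exact sum_congr rfl fun v _ => hcoord k v
    _ = K * #S / n := by simp; ring

/-- The bound on the exponential moments of the size of a `k`-step neighbourhood, by recursion
on `k`. -/
noncomputable def momentBound (K : ℕ) (d x : ℝ) : ℕ → ℝ
  | 0 => Real.exp x
  | k + 1 => momentBound K d x k * Real.exp (d * K * momentBound K d x k ^ K)

theorem one_le_momentBound {d x : ℝ} (hd : 0 ≤ d) (hx : 0 ≤ x) (k : ℕ) :
    1 ≤ momentBound K d x k := by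
  induction k with
  | zero => exact Real.one_le_exp hx
  | succ k ih =>
    refine one_le_mul_of_one_le_of_one_le ih (Real.one_le_exp ?_)
    have : 0 ≤ momentBound K d x k := by linarith
    positivity

/-- Exponential moments of neighbourhood sizes. The set of the clauses that meet `S` is
replaced by a sum over all sets `B` of clauses that meet `S`; the clauses outside `B` are then
independent of those in `B`, without any conditioning. -/
theorem expect_exp_card_hull_le (hK : K ≤ n) {d x : ℝ} (hd : 0 ≤ d) (hx : 0 ≤ x)
    (hm : (m : ℝ) ≤ d * n) (k : ℕ) (I : Finset (Fin m)) (S : Finset (Fin n)) :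
    𝔼 Φ : Formula K n m, Real.exp (x * #(hull Φ I k S)) ≤ momentBound K d x k ^ #S := by
  classical
  have := Clause.nonempty hK
  induction k generalizing I S with
  | zero =>
    simp only [hull_zero, momentBound]
    rw [Fintype.expect_const, ← Real.exp_nat_mul, mul_comm]
  | succ k ih =>
    set M := momentBound K d x k
    have hM : 1 ≤ M := one_le_momentBound hd hx k
    have hM0 : 0 ≤ M := by linarith
    let hit : Clause K n → ℝ := Set.indicator {C | ∃ v ∈ S, v ∈ C.vars} (fun _ => (1 : ℝ))
    have hhit0 : ∀ C, 0 ≤ hit C := fun C => Set.indicator_nonneg (fun _ _ => zero_le_one) C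
    let T : Formula K n m → Finset (Fin m) → Finset (Fin n) :=
      fun Φ B => S ∪ B.biUnion fun a => (Φ a).vars
    have hT : ∀ Φ B, #(T Φ B) ≤ #S + K * #B := by
      intro Φ B
      refine (card_union_le _ _).trans (Nat.add_le_add_left ?_ _)
      refine (card_biUnion_le).trans ?_
      simp [Clause.card_vars, mul_comm]
    have hterm : ∀ B ∈ I.powerset,
        𝔼 Φ : Formula K n m, (∏ a ∈ B, hit (Φ a)) * Real.exp (x * #(hull Φ (I \ B) k (T Φ B)))
          ≤ M ^ #S * (M ^ K * (K * #S / n)) ^ #B := by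
      intro B _
      rw [expect_diag_eq_expect_expect B (fun Φ Ψ : Formula K n m =>
        (∏ a ∈ B, hit (Φ a)) * Real.exp (x * #(hull Ψ (I \ B) k (T Φ B))))]
      · calc _ ≤ 𝔼 Φ : Formula K n m, (∏ a ∈ B, hit (Φ a)) * M ^ (#S + K * #B) := by
              refine expect_le_expect fun Φ _ => ?_
              rw [← mul_expect]
              refine mul_le_mul_of_nonneg_left ?_ (prod_nonneg fun a _ => hhit0 _)
              exact (ih (I \ B) (T Φ B)).trans (pow_le_pow_right₀ hM (hT Φ B))
          _ = (𝔼 C, hit C) ^ #B * M ^ (#S + K * #B) := by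
              rw [← expect_mul, expect_prod_eq_prod_expect]
          _ ≤ (K * #S / n) ^ #B * M ^ (#S + K * #B) := by
              gcongr
              · exact expect_nonneg fun C _ => hhit0 C
              · exact expect_clause_meets_le hK S
          _ = _ := by rw [pow_add, pow_mul, mul_pow]; ring
      · intro Φ Φ' Ψ h
        have h1 : T Φ B = T Φ' B := by
          simp only [T]
          congr 1
          exact biUnion_congr rfl fun a ha => by rw [h a ha]
        rw [h1, prod_congr rfl fun a ha => by rw [h a ha]]
      · intro Φ Ψ Ψ' h
        have h1 : hull Ψ (I \ B) k (T Φ B) = hull Ψ' (I \ B) k (T Φ B) := by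
          ext v
          simp only [mem_hull]
          refine exists_congr fun u => and_congr_right fun _ => Reach.congr fun a ha => ?_
          exact h a (mem_sdiff.1 ha).2
        rw [h1]
    calc _ ≤ 𝔼 Φ : Formula K n m, ∑ B ∈ I.powerset,
            (∏ a ∈ B, hit (Φ a)) * Real.exp (x * #(hull Φ (I \ B) k (T Φ B))) := by
          refine expect_le_expect fun Φ _ => ?_
          have hA : touching Φ I S ∈ I.powerset := by
            simp [touching]
          refine le_trans ?_ (single_le_sum (f := fun B => (∏ a ∈ B, hit (Φ a)) *
            Real.exp (x * #(hull Φ (I \ B) k (T Φ B)))) (fun B _ => mul_nonneg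
              (prod_nonneg fun a _ => hhit0 _) (Real.exp_pos _).le) hA)
          have h1 : ∏ a ∈ touching Φ I S, hit (Φ a) = 1 := by
            refine prod_eq_one fun a ha => Set.indicator_of_mem ?_ _
            exact (mem_filter.1 ha).2
          simp only [h1, one_mul]
          gcongr
          exact hull_succ_subset Φ I k S
      _ ≤ ∑ B ∈ I.powerset, M ^ #S * (M ^ K * (K * #S / n)) ^ #B := by
          rw [expect_sum_comm]
          exact sum_le_sum hterm
      _ = M ^ #S * (1 + M ^ K * (K * #S / n)) ^ #I := by
          rw [← mul_sum, add_comm 1, ← Finset.sum_pow_mul_eq_add_pow]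
          simp
      _ ≤ M ^ #S * Real.exp (M ^ K * (K * #S / n)) ^ m := by
          have hI : #I ≤ m := by simpa using card_le_univ I
          have h0 : 0 ≤ M ^ K * (K * #S / n : ℝ) := by positivity
          gcongr
          calc _ ≤ Real.exp (M ^ K * (K * #S / n)) ^ #I := by
                gcongr
                rw [add_comm]
                exact Real.add_one_le_exp _
            _ ≤ _ := pow_le_pow_right₀ (Real.one_le_exp h0) hI
      _ ≤ M ^ #S * Real.exp (d * K * M ^ K) ^ #S := by
          gcongr
          rw [← Real.exp_nat_mul, ← Real.exp_nat_mul]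
          refine Real.exp_le_exp.2 ?_
          rcases Nat.eq_zero_or_pos n with rfl | hn
          · simp
            positivity
          · have hn' : (0 : ℝ) < n := by exact_mod_cast hn
            calc (m : ℝ) * (M ^ K * (K * #S / n)) ≤ d * n * (M ^ K * (K * #S / n)) := by gcongr
              _ = #S * (d * K * M ^ K) := by field_simp
      _ = _ := by rw [← mul_pow]; rfl

/-! ### Increasing chains and the label symmetry -/

/-- The number of variables within `r` steps of the variable `v`. -/
noncomputable def ballCard (Φ : Formula K n m) (r : ℕ) (v : Fin n) : ℕ := #(hull Φ univ r {v})

theorem mem_hull_singleton {Φ : Formula K n m} {I : Finset (Fin m)} {k : ℕ} {u v : Fin n} :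
    v ∈ hull Φ I k {u} ↔ Reach Φ I k u v := by
  simp [mem_hull]

theorem one_le_ballCard (Φ : Formula K n m) (r : ℕ) (v : Fin n) : 1 ≤ ballCard Φ r v :=
  card_pos.2 ⟨v, mem_hull_singleton.2 (Reach.refl r v)⟩

/-- A sequence of variables in which consecutive ones are at most `r` steps apart, and such that
all of them except possibly the first one have at most `M` variables within `r` steps. -/
def LightTrail (Φ : Formula K n m) (r M : ℕ) {l : ℕ} (c : Fin (l + 1) → Fin n) : Prop :=
  ∀ i : Fin l, Reach Φ univ r (c i.castSucc) (c i.succ) ∧ ballCard Φ r (c i.succ) ≤ M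

/-- Renaming the variables of a formula. -/
def Formula.rename (π : Equiv.Perm (Fin n)) : Formula K n m ≃ Formula K n m :=
  Equiv.piCongrRight fun _ => Clause.rename π

theorem Clause.vars_rename (π : Equiv.Perm (Fin n)) (C : Clause K n) (v : Fin n) :
    π v ∈ (Clause.rename π C).vars ↔ v ∈ C.vars := by
  simp only [Clause.mem_vars]
  refine exists_congr fun k => ?_
  change π (C.1 k) = π v ↔ _
  simp

theorem reach_rename (π : Equiv.Perm (Fin n)) (Φ : Formula K n m) (I : Finset (Fin m)) (k : ℕ)
    (u v : Fin n) : Reach (Formula.rename π Φ) I k (π u) (π v) ↔ Reach Φ I k u v := by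
  induction k generalizing u with
  | zero => simp [Reach]
  | succ k ih =>
    simp only [Reach]
    rw [← π.exists_congr_right]
    refine exists_congr fun w => and_congr (or_congr (by simp) ?_) (ih w)
    refine exists_congr fun a => and_congr_right fun _ => ?_
    exact and_congr (Clause.vars_rename π _ _) (Clause.vars_rename π _ _)

theorem ballCard_rename (π : Equiv.Perm (Fin n)) (Φ : Formula K n m) (r : ℕ) (v : Fin n) :
    ballCard (Formula.rename π Φ) r (π v) = ballCard Φ r v := by
  have : hull (Formula.rename π Φ) univ r {π v} = (hull Φ univ r {v}).map π.toEmbedding := by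
    ext w
    obtain ⟨w, rfl⟩ := π.surjective w
    rw [mem_hull_singleton, reach_rename]
    simp [mem_hull_singleton]
  rw [ballCard, this, card_map, ballCard]

theorem lightTrail_rename (π : Equiv.Perm (Fin n)) (Φ : Formula K n m) (r M : ℕ) {l : ℕ}
    (c : Fin (l + 1) → Fin n) :
    LightTrail (Formula.rename π Φ) r M (π ∘ c) ↔ LightTrail Φ r M c := by
  simp only [LightTrail, Function.comp_apply, reach_rename, ballCard_rename]

open Classical in
/-- As the law of the random formula is invariant under renaming the variables, only a fraction
`1 / (l + 1)!` of the sequences of `l + 1` variables with a given structural property is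
increasing. -/
theorem factorial_mul_expect_card_strictMono_le {l : ℕ}
    (Q : Formula K n m → (Fin (l + 1) → Fin n) → Prop)
    (hQ : ∀ π Φ c, Q (Formula.rename π Φ) (π ∘ c) ↔ Q Φ c) :
    ((l + 1).factorial : ℝ) * 𝔼 Φ, (#{c : Fin (l + 1) → Fin n | StrictMono c ∧ Q Φ c} : ℝ)
      ≤ 𝔼 Φ, (#{c : Fin (l + 1) → Fin n | Q Φ c} : ℝ) := by
  let p : (Fin (l + 1) → Fin n) → ℝ := fun c => 𝔼 Φ : Formula K n m, if Q Φ c then 1 else 0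
  have hp0 : ∀ c, 0 ≤ p c := fun c => expect_nonneg fun Φ _ => by positivity
  have hp : ∀ (c : Fin (l + 1) → Fin n) (ρ : Equiv.Perm (Fin (l + 1))), Function.Injective c →
      p (c ∘ ρ) = p c := by
    intro c ρ hc
    let π : Equiv.Perm (Fin n) := ρ.viaFintypeEmbedding ⟨c, hc⟩
    have hπ : c ∘ ρ = π ∘ c := by
      ext i
      have := ρ.viaFintypeEmbedding_apply_image ⟨c, hc⟩ i
      simp only [Function.Embedding.coeFn_mk] at this
      simp [π, this]
    refine (Fintype.expect_equiv (Formula.rename π) _ _ fun Φ => ?_).symm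
    rw [hπ]
    simp only [hQ]
  have h₁ : 𝔼 Φ, (#{c : Fin (l + 1) → Fin n | StrictMono c ∧ Q Φ c} : ℝ)
      = ∑ c : Fin (l + 1) → Fin n with StrictMono c, p c := by
    rw [← expect_sum_comm]
    refine expect_congr rfl fun Φ _ => ?_
    rw [← filter_filter, ← natCast_card_filter]
  have h₂ : 𝔼 Φ, (#{c : Fin (l + 1) → Fin n | Q Φ c} : ℝ) = ∑ c, p c := by
    rw [← expect_sum_comm]
    refine expect_congr rfl fun Φ _ => ?_
    rw [← natCast_card_filter]
  rw [h₁, h₂, mul_sum]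
  calc _ = ∑ c : Fin (l + 1) → Fin n with StrictMono c,
          ∑ ρ : Equiv.Perm (Fin (l + 1)), p (c ∘ ρ) := by
        refine sum_congr rfl fun c hc => ?_
        rw [sum_congr rfl fun ρ _ => hp c ρ (mem_filter.1 hc).2.injective]
        simp [Fintype.card_perm]
    _ = ∑ q ∈ ({c : Fin (l + 1) → Fin n | StrictMono c} : Finset _) ×ˢ
          (univ : Finset (Equiv.Perm (Fin (l + 1)))), p (q.1 ∘ q.2) := by
        rw [sum_product]
    _ = ∑ c ∈ (({c : Fin (l + 1) → Fin n | StrictMono c} : Finset _) ×ˢ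
          (univ : Finset (Equiv.Perm (Fin (l + 1))))).image (fun q => q.1 ∘ q.2), p c := by
        rw [sum_image]
        rintro ⟨c, ρ⟩ h ⟨c', ρ'⟩ h' heq
        have hc : StrictMono c := by simpa using h
        have hc' : StrictMono c' := by simpa using h'
        have hcc : c = c' := by
          refine (hc.range_inj hc').1 ?_
          have := congrArg Set.range heq
          simpa [Set.range_comp] using this
        subst hcc
        refine Prod.ext rfl (Equiv.ext fun i => hc.injective (congrFun heq i))
    _ ≤ ∑ c, p c := sum_le_sum_of_subset_of_nonneg (subset_univ _) fun c _ _ => hp0 c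

open Classical in
theorem card_lightTrail_from_le (Φ : Formula K n m) (r M l : ℕ) (v : Fin n) :
    #{c : Fin (l + 1) → Fin n | c 0 = v ∧ LightTrail Φ r M c} ≤ ballCard Φ r v * M ^ l := by
  induction l generalizing v with
  | zero =>
    refine le_trans (card_le_one.2 ?_) (by simpa using one_le_ballCard Φ r v)
    intro c hc c' hc'
    simp only [mem_filter] at hc hc'
    ext i
    rw [show i = 0 from Fin.ext (by omega), hc.2.1, hc'.2.1]
  | succ l ih =>
    have hsub : ({c : Fin (l + 2) → Fin n | c 0 = v ∧ LightTrail Φ r M c} : Finset _) ⊆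
        ({w ∈ hull Φ univ r {v} | ballCard Φ r w ≤ M}).biUnion fun w =>
          ({c : Fin (l + 1) → Fin n | c 0 = w ∧ LightTrail Φ r M c} : Finset _).image
            (Fin.cons (α := fun _ => Fin n) v) := by
      intro c hc
      simp only [mem_filter, mem_univ, true_and] at hc
      obtain ⟨rfl, hc⟩ := hc
      refine mem_biUnion.2 ⟨c 1, mem_filter.2 ⟨mem_hull_singleton.2 (hc 0).1, (hc 0).2⟩, ?_⟩
      refine mem_image.2 ⟨Fin.tail c, mem_filter.2 ⟨mem_univ _, rfl, fun i => ?_⟩,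
        Fin.cons_self_tail c⟩
      exact hc i.succ
    calc _ ≤ _ := card_le_card hsub
      _ ≤ ∑ w ∈ hull Φ univ r {v} with ballCard Φ r w ≤ M, M * M ^ l := by
          refine card_biUnion_le.trans (sum_le_sum fun w hw => card_image_le.trans ?_)
          exact (ih w).trans (Nat.mul_le_mul_right _ (mem_filter.1 hw).2)
      _ ≤ ballCard Φ r v * M ^ (l + 1) := by
          rw [sum_const, smul_eq_mul, pow_succ']
          exact Nat.mul_le_mul_right _ (card_filter_le _ _)

/-! ### Influence of one variable on another -/

/-- The variable `i` directly influences the later variable `j`, when `j` is at most `r` steps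
away. -/
def Link (Φ : Formula K n m) (r : ℕ) (i j : Fin n) : Prop := i < j ∧ Reach Φ univ r i j

/-- The decision on `i` may influence the decision on `j`, through a chain of direct
influences. -/
def Influences (Φ : Formula K n m) (r : ℕ) : Fin n → Fin n → Prop :=
  Relation.ReflTransGen (Link Φ r)

open Classical in
/-- The ends of the increasing light trails that have `L` steps, or that have fewer steps and start
at a variable with more than `M` variables within `r` steps. A chain of influence that is long or
meets a variable with a large neighbourhood ends here: cut it at the last such variable, or at its
last `L` steps. -/
noncomputable def badEnds (Φ : Formula K n m) (r M L : ℕ) : Finset (Fin n) :=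
  (range (L + 1)).biUnion fun l =>
    ({c : Fin (l + 1) → Fin n | StrictMono c ∧ LightTrail Φ r M c ∧
      (l = L ∨ M < ballCard Φ r (c 0))} : Finset _).image fun c => c (Fin.last l)

/-- The chains of influence that end at a variable outside `badEnds` are short. -/
theorem Influences.reach {Φ : Formula K n m} {r M L : ℕ} {i j : Fin n}
    (hj : j ∉ badEnds Φ r M L) (h : Influences Φ r i j) : Reach Φ univ (r * L) i j := by
  suffices H : ∃ l, l < L ∧ ∃ c : Fin (l + 1) → Fin n, StrictMono c ∧ LightTrail Φ r M c ∧
      ballCard Φ r (c 0) ≤ M ∧ c 0 = i ∧ c (Fin.last l) = j ∧ Reach Φ univ (r * l) i j by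
    obtain ⟨l, hl, -, -, -, -, -, -, h⟩ := H
    exact h.mono (Nat.mul_le_mul_left r hl.le)
  have hbad : ∀ l ≤ L, ∀ c : Fin (l + 1) → Fin n, StrictMono c → LightTrail Φ r M c →
      c (Fin.last l) = j → l < L ∧ ballCard Φ r (c 0) ≤ M := by
    intro l hl c hc hc' hcj
    by_contra hcon
    classical
    refine hj (mem_biUnion.2 ⟨l, mem_range.2 (by omega), mem_image.2 ⟨c, mem_filter.2
      ⟨mem_univ _, hc, hc', ?_⟩, hcj⟩⟩)
    by_contra hcon'
    push Not at hcon'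
    exact hcon ⟨lt_of_le_of_ne hl hcon'.1, hcon'.2⟩
  induction h using Relation.ReflTransGen.head_induction_on with
  | refl =>
    have h0 : StrictMono (fun _ : Fin (0 + 1) => j) := fun a b h => by omega
    have h1 : LightTrail Φ r M (fun _ : Fin (0 + 1) => j) := fun i => i.elim0
    obtain ⟨h2, h3⟩ := hbad 0 (Nat.zero_le _) _ h0 h1 rfl
    exact ⟨0, h2, _, h0, h1, h3, rfl, rfl, Reach.refl _ _⟩
  | @head i i' hii' _ ih =>
    obtain ⟨l, hl, c, hc, hc', hb, rfl, hcj, hreach⟩ := ih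
    have h0 : StrictMono (Fin.cons (α := fun _ => Fin n) i c) := by
      rw [Fin.strictMono_iff_lt_succ]
      intro k
      induction k using Fin.cases with
      | zero => simpa using hii'.1
      | succ k => simpa [← Fin.succ_castSucc] using hc (Fin.castSucc_lt_succ (i := k))
    have h1 : LightTrail Φ r M (Fin.cons (α := fun _ => Fin n) i c) := by
      intro k
      induction k using Fin.cases with
      | zero => simpa using ⟨hii'.2, hb⟩
      | succ k => simpa [← Fin.succ_castSucc] using hc' k
    have h2 : Fin.cons (α := fun _ => Fin n) i c (Fin.last (l + 1)) = j := by
      rw [← Fin.succ_last, Fin.cons_succ, hcj]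
    obtain ⟨h3, h4⟩ := hbad (l + 1) hl _ h0 h1 h2
    refine ⟨l + 1, h3, _, h0, h1, h4, rfl, h2, ?_⟩
    rw [Nat.mul_succ, Nat.add_comm]
    exact hii'.2.trans hreach

theorem expect_exp_ballCard_le (hK : K ≤ n) {d x : ℝ} (hd : 0 ≤ d) (hx : 0 ≤ x)
    (hm : (m : ℝ) ≤ d * n) (k : ℕ) (v : Fin n) :
    𝔼 Φ : Formula K n m, Real.exp (x * ballCard Φ k v) ≤ momentBound K d x k := by
  simpa [ballCard] using expect_exp_card_hull_le hK hd hx hm k univ {v}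

/-- There are at most `b M ^ l` light trails with `l` steps from a variable with `b` variables
within `r` steps, and a fraction of at most `1 / (l + 1)!` of them is increasing. For `l < L` only starting
variables with `b > M` count, and the exponential moment of `b` makes up for the factor
`∑ M ^ l / l! ≤ exp M`. -/
theorem expect_card_badEnds_le (hK : K ≤ n) {d : ℝ} (hd : 0 ≤ d) (hm : (m : ℝ) ≤ d * n)
    (r M L : ℕ) :
    𝔼 Φ : Formula K n m, (#(badEnds Φ r M L) : ℝ) ≤
      n * ((M : ℝ) ^ L / L.factorial * momentBound K d 1 r
        + Real.exp (-M) * momentBound K d 3 r) := by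
  classical
  have := Clause.nonempty hK
  let S : ℕ → Formula K n m → ℝ := fun l Φ =>
    ∑ v, if l = L ∨ M < ballCard Φ r v then (ballCard Φ r v : ℝ) * M ^ l else 0
  have hcount : ∀ l, 𝔼 Φ : Formula K n m, (#{c : Fin (l + 1) → Fin n | StrictMono c ∧
      LightTrail Φ r M c ∧ (l = L ∨ M < ballCard Φ r (c 0))} : ℝ)
        ≤ ((l + 1).factorial : ℝ)⁻¹ * 𝔼 Φ, S l Φ := by
    intro l
    have h₁ := factorial_mul_expect_card_strictMono_le (K := K) (n := n) (m := m) (l := l)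
      (fun Φ c => LightTrail Φ r M c ∧ (l = L ∨ M < ballCard Φ r (c 0))) (by
        intro π Φ c
        simp only [lightTrail_rename, Function.comp_apply, ballCard_rename])
    rw [inv_mul_eq_div, le_div_iff₀' (by positivity)]
    refine le_trans (b := 𝔼 Φ : Formula K n m, (#{c : Fin (l + 1) → Fin n | LightTrail Φ r M c ∧
      (l = L ∨ M < ballCard Φ r (c 0))} : ℝ)) (by convert h₁; rfl) (expect_le_expect fun Φ _ => ?_)
    have h₂ : ({c : Fin (l + 1) → Fin n | LightTrail Φ r M c ∧
        (l = L ∨ M < ballCard Φ r (c 0))} : Finset _) ⊆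
        ({v | l = L ∨ M < ballCard Φ r v} : Finset (Fin n)).biUnion fun v =>
          {c : Fin (l + 1) → Fin n | c 0 = v ∧ LightTrail Φ r M c} := by
      intro c hc
      simp only [mem_filter, mem_univ, true_and] at hc
      simp only [mem_biUnion, mem_filter, mem_univ, true_and]
      exact ⟨c 0, hc.2, rfl, hc.1⟩
    have h₃ := (card_le_card h₂).trans (card_biUnion_le.trans
      (sum_le_sum fun v _ => card_lightTrail_from_le Φ r M l v))
    simp only [S]
    rw [← sum_filter]
    exact_mod_cast h₃
  calc _ ≤ 𝔼 Φ : Formula K n m, ∑ l ∈ range (L + 1), (#{c : Fin (l + 1) → Fin n | StrictMono c ∧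
        LightTrail Φ r M c ∧ (l = L ∨ M < ballCard Φ r (c 0))} : ℝ) := by
        refine expect_le_expect fun Φ _ => ?_
        refine le_trans (Nat.cast_le.2 card_biUnion_le) ?_
        rw [Nat.cast_sum]
        exact sum_le_sum fun l _ => Nat.cast_le.2 card_image_le
    _ ≤ ∑ l ∈ range (L + 1), ((l + 1).factorial : ℝ)⁻¹ * 𝔼 Φ, S l Φ := by
        rw [expect_sum_comm]
        exact sum_le_sum fun l _ => hcount l
    _ = 𝔼 Φ : Formula K n m, ∑ v, ∑ l ∈ range (L + 1), ((l + 1).factorial : ℝ)⁻¹ *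
          (if l = L ∨ M < ballCard Φ r v then (ballCard Φ r v : ℝ) * M ^ l else 0) := by
        simp_rw [mul_expect]
        rw [← expect_sum_comm]
        refine expect_congr rfl fun Φ _ => ?_
        simp only [S, mul_sum]
        exact sum_comm
    _ ≤ 𝔼 Φ : Formula K n m, ∑ v, ((M : ℝ) ^ L / L.factorial * Real.exp (1 * ballCard Φ r v)
          + Real.exp (-M) * Real.exp (3 * ballCard Φ r v)) := by
        refine expect_le_expect fun Φ _ => sum_le_sum fun v _ => ?_
        set b := ballCard Φ r v
        have hbe : (b : ℝ) ≤ Real.exp b := by linarith [Real.add_one_le_exp (b : ℝ)]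
        calc _ ≤ ∑ l ∈ range (L + 1), ((if l = L then (M : ℝ) ^ l / l.factorial * b else 0)
              + (M : ℝ) ^ l / l.factorial * (if M < b then (b : ℝ) else 0)) := by
              refine sum_le_sum fun l _ => ?_
              have h1 : ((l + 1).factorial : ℝ)⁻¹ * (b * M ^ l) ≤
                  (M : ℝ) ^ l / l.factorial * b := by
                calc _ ≤ (l.factorial : ℝ)⁻¹ * (b * M ^ l) := by gcongr; exact Nat.le_succ l
                  _ = _ := by ring
              have h0 : 0 ≤ (M : ℝ) ^ l / l.factorial * b := by positivity
              split_ifs <;> first | linarith | (exfalso; tauto)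
          _ = (M : ℝ) ^ L / L.factorial * b + (∑ l ∈ range (L + 1), (M : ℝ) ^ l / l.factorial) *
                (if M < b then (b : ℝ) else 0) := by
              rw [sum_add_distrib, ← sum_mul, sum_ite_eq' (range (L + 1)) L]
              simp
          _ ≤ _ := by
              refine add_le_add ?_ ?_
              · rw [one_mul]
                gcongr
              · have h2 := Real.sum_le_exp_of_nonneg (x := (M : ℝ)) (by positivity) (L + 1)
                split_ifs with hMb
                · have hMb' : (M : ℝ) ≤ b := by exact_mod_cast hMb.le
                  calc _ ≤ Real.exp M * Real.exp b := by gcongr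
                    _ ≤ Real.exp (-M) * Real.exp (3 * b) := by
                      rw [← Real.exp_add, ← Real.exp_add]
                      exact Real.exp_le_exp.2 (by linarith)
                · rw [mul_zero]
                  positivity
    _ ≤ ∑ v : Fin n, ((M : ℝ) ^ L / L.factorial * momentBound K d 1 r
          + Real.exp (-M) * momentBound K d 3 r) := by
        rw [expect_sum_comm]
        refine sum_le_sum fun v _ => ?_
        rw [expect_add_distrib, ← mul_expect, ← mul_expect]
        gcongr
        · exact expect_exp_ballCard_le hK hd zero_le_one hm r v
        · exact expect_exp_ballCard_le hK hd (by norm_num) hm r v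
    _ = _ := by simp [mul_add]

open Classical in
/-- The pairs of variables that are both influenced by some third variable. -/
noncomputable def correlatedPairs (Φ : Formula K n m) (r : ℕ) : Finset (Fin n × Fin n) :=
  {p | ∃ i, Influences Φ r i p.1 ∧ Influences Φ r i p.2}

theorem card_correlatedPairs_le (Φ : Formula K n m) (r M L : ℕ) :
    #(correlatedPairs Φ r) ≤
      2 * n * #(badEnds Φ r M L) + ∑ v, ballCard Φ (r * L + r * L) v := by
  classical
  have hsub : correlatedPairs Φ r ⊆ (badEnds Φ r M L ×ˢ univ ∪ univ ×ˢ badEnds Φ r M L) ∪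
      univ.biUnion fun v => {v} ×ˢ hull Φ univ (r * L + r * L) {v} := by
    rintro ⟨j, j'⟩ h
    obtain ⟨i, hi, hi'⟩ := (mem_filter.1 h).2
    by_cases hj : j ∈ badEnds Φ r M L
    · simp [hj]
    by_cases hj' : j' ∈ badEnds Φ r M L
    · simp [hj']
    refine mem_union_right _ (mem_biUnion.2 ⟨j, mem_univ _, mem_product.2
      ⟨mem_singleton_self _, mem_hull_singleton.2 ?_⟩⟩)
    exact (hi.reach hj).symm.trans (hi'.reach hj')
  refine (card_le_card hsub).trans ((card_union_le _ _).trans (add_le_add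
    ((card_union_le _ _).trans (le_of_eq ?_)) (card_biUnion_le.trans (le_of_eq ?_))))
  · simp only [card_product, card_univ, Fintype.card_fin]
    ring
  · simp [ballCard]

/-- On average over the formula, only `o(n²)` pairs of variables are influenced by a common
variable. -/
theorem exists_expect_card_correlatedPairs_le (K r : ℕ) {d δ : ℝ} (hd : 0 ≤ d) (hδ : 0 < δ) :
    ∃ N : ℕ, ∀ n m : ℕ, N ≤ n → K ≤ n → (m : ℝ) ≤ d * n →
      𝔼 Φ : Formula K n m, (#(correlatedPairs Φ r) : ℝ) ≤ δ * n ^ 2 := by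
  have hE1 : 0 < momentBound K d 1 r := by linarith [one_le_momentBound (K := K) hd zero_le_one r]
  have hE3 : 0 < momentBound K d 3 r := by
    linarith [one_le_momentBound (K := K) (x := 3) hd (by norm_num) r]
  obtain ⟨M, hM⟩ : ∃ M : ℕ, Real.exp (-M) * momentBound K d 3 r ≤ δ / 8 := by
    have h : Filter.Tendsto (fun M : ℕ => Real.exp (-(M : ℝ)) * momentBound K d 3 r)
        Filter.atTop (nhds (0 * momentBound K d 3 r)) :=
      (Real.tendsto_exp_neg_atTop_nhds_zero.comp tendsto_natCast_atTop_atTop).mul_const _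
    rw [zero_mul] at h
    exact (h.eventually (ge_mem_nhds (by positivity : (0 : ℝ) < δ / 8))).exists
  obtain ⟨L, hL⟩ : ∃ L : ℕ, (M : ℝ) ^ L / L.factorial * momentBound K d 1 r ≤ δ / 8 := by
    have h := (FloorSemiring.tendsto_pow_div_factorial_atTop (M : ℝ)).mul_const
      (momentBound K d 1 r)
    rw [zero_mul] at h
    exact (h.eventually (ge_mem_nhds (by positivity : (0 : ℝ) < δ / 8))).exists
  set E := momentBound K d 1 (r * L + r * L)
  obtain ⟨N, hN⟩ := exists_nat_ge (2 * E / δ)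
  refine ⟨N, fun n m hn hK hm => ?_⟩
  have := Clause.nonempty hK
  have hn' : 2 * E / δ ≤ n := hN.trans (by exact_mod_cast hn)
  rw [div_le_iff₀ hδ] at hn'
  calc _ ≤ 𝔼 Φ : Formula K n m, (2 * n * (#(badEnds Φ r M L) : ℝ)
          + ∑ v, Real.exp (1 * ballCard Φ (r * L + r * L) v)) := by
        refine expect_le_expect fun Φ _ => ?_
        have h := card_correlatedPairs_le Φ r M L
        calc ((#(correlatedPairs Φ r) : ℕ) : ℝ) ≤ ((2 * n * #(badEnds Φ r M L)
              + ∑ v, ballCard Φ (r * L + r * L) v : ℕ) : ℝ) := by exact_mod_cast h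
          _ ≤ _ := by
            push_cast
            gcongr with v
            rw [one_mul]
            linarith [Real.add_one_le_exp (ballCard Φ (r * L + r * L) v : ℝ)]
    _ ≤ 2 * n * (n * (δ / 8 + δ / 8)) + ∑ v : Fin n, E := by
        rw [expect_add_distrib, ← mul_expect, expect_sum_comm]
        gcongr with v
        · refine (expect_card_badEnds_le hK hd hm r M L).trans ?_
          gcongr
        · exact expect_exp_ballCard_le hK hd zero_le_one hm _ v
    _ ≤ δ * n ^ 2 := by
        simp only [sum_const, card_univ, Fintype.card_fin, nsmul_eq_mul]
        nlinarith [(Nat.cast_nonneg n : (0 : ℝ) ≤ n)]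

/-! ### Locality of the sequential algorithm -/

/-- What is left of a clause after the variables `0, …, i - 1` have received the values `σ`. -/
noncomputable def clauseResidual (σ : ℕ → Bool) : ℕ → ReducedClause K → Option (ReducedClause K)
  | 0, C => some C
  | i + 1, C => (clauseResidual σ i C).bind (ReducedClause.assign i (σ i))

theorem ReducedClause.assign_of_not_mentions {v : ℕ} {b : Bool} {C : ReducedClause K}
    (h : ¬ C.Mentions v) : C.assign v b = some C := by
  simp [ReducedClause.assign, h]

theorem ReducedClause.Mentions.of_assign {v w : ℕ} {b : Bool} {C D : ReducedClause K}
    (h : C.assign v b = some D) (hw : D.Mentions w) : C.Mentions w := by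
  classical
  by_cases hv : C.Mentions v
  · simp only [ReducedClause.assign, hv, dif_pos] at h
    split_ifs at h with h'
    all_goals
      obtain rfl := Option.some.inj h
      obtain ⟨ℓ, hℓ, rfl⟩ := hw
      exact ⟨ℓ, (mem_filter.1 hℓ).1, rfl⟩
  · rw [ReducedClause.assign_of_not_mentions hv] at h
    obtain rfl := Option.some.inj h
    exact hw

theorem ReducedClause.Mentions.of_clauseResidual {σ : ℕ → Bool} {i w : ℕ}
    {C D : ReducedClause K} (h : clauseResidual σ i C = some D) (hw : D.Mentions w) :
    C.Mentions w := by
  induction i generalizing D with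
  | zero =>
    obtain rfl := Option.some.inj h
    exact hw
  | succ i ih =>
    obtain ⟨E, hE, hED⟩ := Option.bind_eq_some_iff.1 h
    exact ih hE (hw.of_assign hED)

theorem clauseResidual_congr {σ σ' : ℕ → Bool} {i : ℕ} {C : ReducedClause K}
    (h : ∀ v < i, C.Mentions v → σ v = σ' v) :
    clauseResidual σ i C = clauseResidual σ' i C := by
  induction i with
  | zero => rfl
  | succ i ih =>
    have ih' := ih fun v hv => h v (hv.trans (Nat.lt_succ_self i))
    simp only [clauseResidual, ← ih']
    cases hD : clauseResidual σ i C with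
    | none => rfl
    | some D =>
      by_cases hC : C.Mentions i
      · rw [h i (Nat.lt_succ_self i) hC]
      · have hDi : ¬ D.Mentions i := fun h' => hC (h'.of_clauseResidual hD)
        simp [ReducedClause.assign_of_not_mentions hDi]

/-- The extension of an assignment to all variable labels. -/
def extendAssignment (σ : Fin n → Bool) (i : ℕ) : Bool :=
  if h : i < n then σ ⟨i, h⟩ else false

theorem residual_eq_filterMap (hr : Even r) (τ : LocalRule K r) (Φ : Instance K)
    (u : Fin n → unitInterval) {i : ℕ} (hi : i ≤ n) :
    residual hr τ Φ u i = Φ.filterMap (clauseResidual (extendAssignment (output hr τ Φ u)) i) := by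
  induction i with
  | zero =>
    change Φ = Φ.filterMap some
    rw [Multiset.filterMap_some]
  | succ i ih =>
    have hin : i < n := hi
    rw [residual, dif_pos hin]
    have h : extendAssignment (output hr τ Φ u) i
        = decision hr τ (residual hr τ Φ u i) i (u ⟨i, hin⟩) := by
      simp [extendAssignment, hin, output]
    rw [← h, ih hin.le, Instance.assign, Multiset.filterMap_filterMap]
    rfl

theorem Clause.mentions_toReduced {C : Clause K n} {w : ℕ} (h : C.toReduced.Mentions w) :
    ∃ v : Fin n, (v : ℕ) = w ∧ v ∈ C.vars := by
  obtain ⟨ℓ, hℓ, rfl⟩ := h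
  obtain ⟨k, -, rfl⟩ := mem_image.1 hℓ
  exact ⟨C.1 k, rfl, Clause.mem_vars.2 ⟨k, rfl⟩⟩

theorem Clause.mentions_toReduced_iff {C : Clause K n} {v : Fin n} :
    C.toReduced.Mentions v ↔ v ∈ C.vars := by
  refine ⟨fun h => ?_, fun h => ?_⟩
  · obtain ⟨w, hw, hC⟩ := Clause.mentions_toReduced h
    rwa [← Fin.ext hw]
  · obtain ⟨k, rfl⟩ := Clause.mem_vars.1 h
    exact ⟨_, mem_image_of_mem _ (mem_univ k), rfl⟩

/-- The instance left by the formula `Φ` after the first `i` variables have received the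
values `σ`. -/
noncomputable def assignedInstance (Φ : Formula K n m) (σ : ℕ → Bool) (i : ℕ) : Instance K :=
  Φ.toInstance.filterMap (clauseResidual σ i)

theorem mem_assignedInstance {Φ : Formula K n m} {σ : ℕ → Bool} {i : ℕ} {C : ReducedClause K} :
    C ∈ assignedInstance Φ σ i ↔ ∃ a, clauseResidual σ i (Φ a).toReduced = some C := by
  simp [assignedInstance, Formula.toInstance]

section Locality

variable {Φ : Formula K n m} {σ σ' : ℕ → Bool} {i : ℕ} {x : Fin n}

/-- A short walk towards `x` in the factor graph of the residual instance for `σ` only meets clauses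
on whose variables `σ` and `σ'` agree, so it is a walk in the residual instance for `σ'` as well. -/
theorem exists_walk_of_agree
    (h : ∀ v : Fin n, (v : ℕ) < i → Reach Φ univ r x v → σ v = σ' v)
    {y e : ℕ ⊕ ReducedClause K} (p : (factorGraph (assignedInstance Φ σ i)).Walk y e)
    (he : e = .inl (x : ℕ)) (hp : p.length ≤ r) :
    (∃ q : (factorGraph (assignedInstance Φ σ' i)).Walk y e, q.length ≤ p.length) ∧
    (∀ w, y = .inl w → ∃ v : Fin n, (v : ℕ) = w ∧ Reach Φ univ p.length x v) ∧
    (∀ C, y = .inr C → ∀ a, clauseResidual σ i (Φ a).toReduced = some C →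
      clauseResidual σ' i (Φ a).toReduced = some C ∧
        ∀ v ∈ (Φ a).vars, Reach Φ univ p.length x v) := by
  induction p with
  | nil =>
    subst he
    refine ⟨⟨.nil, le_rfl⟩, fun w hw => ⟨x, Sum.inl.inj hw, rfl⟩, fun C hC => by simp at hC⟩
  | @cons y z e hadj p ih =>
    rw [SimpleGraph.Walk.length_cons] at hp ⊢
    obtain ⟨⟨q, hq⟩, ih₁, ih₂⟩ := ih he (by omega)
    rcases y with w | C <;> rcases z with w' | C'
    · exact hadj.elim
    · obtain ⟨hC', hw⟩ := hadj
      obtain ⟨a, ha⟩ := mem_assignedInstance.1 hC'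
      obtain ⟨ha', hreach⟩ := ih₂ C' rfl a ha
      obtain ⟨v, rfl, hv⟩ := Clause.mentions_toReduced (hw.of_clauseResidual ha)
      have hadj' : (factorGraph (assignedInstance Φ σ' i)).Adj (.inl (v : ℕ)) (.inr C') :=
        ⟨mem_assignedInstance.2 ⟨a, ha'⟩, hw⟩
      refine ⟨⟨.cons hadj' q, by simpa using hq⟩, ?_, fun C hC => by simp at hC⟩
      rintro _ ⟨⟩
      exact ⟨v, rfl, (hreach v hv).mono (Nat.le_succ _)⟩
    · obtain ⟨hC, hw⟩ := hadj
      obtain ⟨v, rfl, hv⟩ := ih₁ w' rfl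
      have key : ∀ a, clauseResidual σ i (Φ a).toReduced = some C →
          clauseResidual σ' i (Φ a).toReduced = some C ∧
            ∀ v ∈ (Φ a).vars, Reach Φ univ (p.length + 1) x v := by
        intro a ha
        have hva : v ∈ (Φ a).vars :=
          Clause.mentions_toReduced_iff.1 (hw.of_clauseResidual ha)
        have hall : ∀ v' ∈ (Φ a).vars, Reach Φ univ (p.length + 1) x v' := fun v' hv' =>
          hv.trans (Reach.of_mem_clause (mem_univ a) hva hv')
        refine ⟨?_, hall⟩
        rw [← ha]
        refine (clauseResidual_congr fun w hwi hwa => ?_).symm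
        obtain ⟨v', rfl, hv'⟩ := Clause.mentions_toReduced hwa
        exact h v' hwi ((hall v' hv').mono hp)
      obtain ⟨a, ha⟩ := mem_assignedInstance.1 hC
      have hadj' : (factorGraph (assignedInstance Φ σ' i)).Adj (.inr C) (.inl (v : ℕ)) :=
        ⟨mem_assignedInstance.2 ⟨a, (key a ha).1⟩, hw⟩
      refine ⟨⟨.cons hadj' q, by simpa using hq⟩, fun w hw => by simp at hw, ?_⟩
      rintro _ ⟨⟩
      exact key
    · exact hadj.elim

theorem ball_assignedInstance_congr
    (h : ∀ v : Fin n, (v : ℕ) < i → Reach Φ univ r x v → σ v = σ' v) :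
    ball (assignedInstance Φ σ i) x r = ball (assignedInstance Φ σ' i) x r := by
  classical
  have key : ∀ {σ σ' : ℕ → Bool},
      (∀ v : Fin n, (v : ℕ) < i → Reach Φ univ r x v → σ v = σ' v) → ∀ a C,
      clauseResidual σ i (Φ a).toReduced = some C →
      (factorGraph (assignedInstance Φ σ i)).edist (.inl (x : ℕ)) (.inr C) ≤ r →
      clauseResidual σ' i (Φ a).toReduced = some C ∧
        (factorGraph (assignedInstance Φ σ' i)).edist (.inl (x : ℕ)) (.inr C) ≤ r := by
    intro σ σ' h a C ha hC
    rw [SimpleGraph.edist_comm] at hC ⊢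
    obtain ⟨p, hp⟩ := exists_walk_of_edist_le hC
    obtain ⟨⟨q, hq⟩, -, h₂⟩ := exists_walk_of_agree h p rfl hp
    refine ⟨(h₂ C rfl a ha).1, q.edist_le.trans ?_⟩
    exact_mod_cast hq.trans hp
  have hfm : ∀ σ, ball (assignedInstance Φ σ i) x r = (univ : Finset (Fin m)).val.filterMap
      fun a => (clauseResidual σ i (Φ a).toReduced).bind (Option.guard fun C =>
        (factorGraph (assignedInstance Φ σ i)).edist (.inl (x : ℕ)) (.inr C) ≤ r) := by
    intro σ
    have hP : ∀ (P : ReducedClause K → Prop) [DecidablePred P], (assignedInstance Φ σ i).filter P =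
        (univ : Finset (Fin m)).val.filterMap fun a =>
          (clauseResidual σ i (Φ a).toReduced).bind (Option.guard fun C => P C) := by
      intro P _
      rw [← Multiset.filterMap_eq_filter, assignedInstance, Formula.toInstance,
        Multiset.filterMap_map, Multiset.filterMap_filterMap]
      rfl
    rw [ball, hP]
  rw [hfm, hfm]
  refine congrArg (Multiset.filterMap · _) (funext fun a => Option.ext fun C => ?_)
  simp only [Option.bind_eq_some_iff, Option.guard_eq_some_iff, decide_eq_true_eq]
  constructor
  · rintro ⟨D, hD, rfl, hd⟩
    obtain ⟨h₁, h₂⟩ := key h a D hD hd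
    exact ⟨D, h₁, rfl, h₂⟩
  · rintro ⟨D, hD, rfl, hd⟩
    obtain ⟨h₁, h₂⟩ := key (fun v hv hxv => (h v hv hxv).symm) a D hD hd
    exact ⟨D, h₁, rfl, h₂⟩

end Locality

theorem residual_toInstance (hr : Even r) (τ : LocalRule K r) (Φ : Formula K n m)
    (u : Fin n → unitInterval) (j : Fin n) :
    residual hr τ Φ.toInstance u j
      = assignedInstance Φ (extendAssignment (output hr τ Φ.toInstance u)) j :=
  residual_eq_filterMap hr τ _ u j.2.le

theorem decision_assignedInstance_congr (hr : Even r) (τ : LocalRule K r) {Φ : Formula K n m}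
    {σ σ' : ℕ → Bool} {j : Fin n} (t : unitInterval)
    (h : ∀ v : Fin n, v < j → Reach Φ univ r j v → σ v = σ' v) :
    decision hr τ (assignedInstance Φ σ j) j t = decision hr τ (assignedInstance Φ σ' j) j t := by
  have : nbhd hr (assignedInstance Φ σ j) j = nbhd hr (assignedInstance Φ σ' j) j :=
    RootedInstance.ext (ball_assignedInstance_congr fun v hv => h v hv) rfl
  rw [decision, this, decision]

/-- The value given to `j` depends only on the seeds of the variables that influence `j`. -/
theorem output_congr (hr : Even r) (τ : LocalRule K r) (Φ : Formula K n m)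
    {u u' : Fin n → unitInterval} (j : Fin n) (h : ∀ i, Influences Φ r i j → u i = u' i) :
    output hr τ Φ.toInstance u j = output hr τ Φ.toInstance u' j := by
  induction j using WellFoundedLT.induction with
  | ind j ih =>
    rw [output, output, residual_toInstance, residual_toInstance, ← h j .refl]
    refine decision_assignedInstance_congr hr τ _ fun v hv hjv => ?_
    have hlink : Link Φ r v j := ⟨hv, hjv.symm⟩
    simp only [extendAssignment, v.2, dif_pos]
    exact ih v hv fun i hi => h i (hi.tail hlink)

/-! ### Complementation -/

theorem ReducedClause.compl_compl (C : ReducedClause K) : C.compl.compl = C :=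
  ReducedClause.ext rfl (by simp [ReducedClause.compl])

theorem ReducedClause.assign_compl (v : ℕ) (b : Bool) (C : ReducedClause K) :
    C.compl.assign v (!b) = (C.assign v b).map ReducedClause.compl := by
  classical
  by_cases hv : C.Mentions v
  · have hv' : C.compl.Mentions v := hv
    obtain ⟨⟨w, neg⟩, hℓ, rfl⟩ := hv
    -- Exactly one of the two literals on `v` belongs to the clause, so the sign is reversed.
    have hmem : ∀ c, ((w, c) ∈ C.lits ↔ c = neg) := by
      intro c
      refine ⟨fun hc => ?_, fun hc => hc ▸ hℓ⟩
      exact (Prod.ext_iff.1 (C.injOn hc hℓ rfl)).2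
    have hv : C.Mentions w := hv'
    simp only [ReducedClause.assign, hv, hv', dif_pos]
    have hs : (if (w, !!b) ∈ C.compl.lits then (1 : SignType) else -1)
        = -(if (w, !b) ∈ C.lits then (1 : SignType) else -1) := by
      change (if (w, !!b) ∈ C.lits then (1 : SignType) else -1) = _
      simp only [hmem]
      cases b <;> cases neg <;> simp
    have hcond : (C.compl.sign = -(if (w, !!b) ∈ C.compl.lits then (1 : SignType) else -1) ∨
        (C.compl.lits.filter fun ℓ => ℓ.1 ≠ w) = ∅) ↔
        (C.sign = -(if (w, !b) ∈ C.lits then (1 : SignType) else -1) ∨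
        (C.lits.filter fun ℓ => ℓ.1 ≠ w) = ∅) := by
      rw [hs]
      refine or_congr ?_ Iff.rfl
      change -C.sign = _ ↔ _
      rw [neg_inj]
    by_cases hc : (C.sign = -(if (w, !b) ∈ C.lits then (1 : SignType) else -1) ∨
        (C.lits.filter fun ℓ => ℓ.1 ≠ w) = ∅)
    · rw [if_pos hc, if_pos (hcond.2 hc)]
      rfl
    · rw [if_neg hc, if_neg (fun h => hc (hcond.1 h))]
      refine congrArg some (ReducedClause.ext rfl hs)
  · rw [ReducedClause.assign_of_not_mentions (C := C) hv,
      ReducedClause.assign_of_not_mentions (C := C.compl) hv]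
    rfl

theorem Instance.compl_compl (Ψ : Instance K) : Ψ.compl.compl = Ψ := by
  simp [Instance.compl, ReducedClause.compl_compl]

theorem Instance.assign_compl (v : ℕ) (b : Bool) (Ψ : Instance K) :
    Ψ.compl.assign v (!b) = (Ψ.assign v b).compl := by
  rw [Instance.compl, Instance.compl, Instance.assign, Instance.assign, Multiset.filterMap_map,
    Multiset.map_filterMap]
  exact congrArg (Multiset.filterMap · _) (funext fun C => ReducedClause.assign_compl v b C)

theorem edist_compl_le (Ψ : Instance K) (x : ℕ) (C : ReducedClause K) :
    (factorGraph Ψ.compl).edist (.inl x) (.inr C.compl) ≤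
      (factorGraph Ψ).edist (.inl x) (.inr C) := by
  let f : factorGraph Ψ →g factorGraph Ψ.compl :=
    { toFun := Sum.map id ReducedClause.compl
      map_rel' := by
        rintro (a | E) (b | F) h
        · exact h
        · exact ⟨Multiset.mem_map_of_mem _ h.1, h.2⟩
        · exact ⟨Multiset.mem_map_of_mem _ h.1, h.2⟩
        · exact h }
  by_cases htop : (factorGraph Ψ).edist (.inl x) (.inr C) = ⊤
  · rw [htop]
    exact le_top
  · obtain ⟨p, hp⟩ := SimpleGraph.exists_walk_of_edist_ne_top htop
    rw [← hp, ← SimpleGraph.Walk.length_map f p]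
    exact (p.map f).edist_le

theorem nbhd_compl (hr : Even r) (Ψ : Instance K) (x : ℕ) :
    nbhd hr Ψ.compl x = (nbhd hr Ψ x).compl := by
  classical
  refine RootedInstance.ext ?_ rfl
  change ball Ψ.compl x r = (ball Ψ x r).map _
  rw [ball, ball]
  conv_lhs => rw [Instance.compl, Multiset.filter_map]
  refine congrArg _ (Multiset.filter_congr fun C _ => ?_)
  have h : (factorGraph Ψ.compl).edist (.inl x) (.inr C.compl)
      = (factorGraph Ψ).edist (.inl x) (.inr C) := by
    refine le_antisymm (edist_compl_le Ψ x C) ?_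
    have := edist_compl_le Ψ.compl x C.compl
    rwa [Instance.compl_compl, ReducedClause.compl_compl] at this
  rw [← h]
  rfl

theorem Formula.compl_toInstance (Φ : Formula K n m) : Φ.toInstance.compl = Φ.toInstance := by
  rw [Instance.compl, Formula.toInstance, Multiset.map_map]
  exact Multiset.map_congr rfl fun a _ => ReducedClause.ext rfl rfl

/-- Reversing the seeds complements the decision, unless the seed lies exactly on the threshold. -/
theorem decision_compl (hr : Even r) {τ : LocalRule K r} (hτ : τ.IsBalanced) (Ψ : Instance K)
    (x : ℕ) (t : unitInterval) (ht : t ≠ τ (nbhd hr Ψ x)) :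
    decision hr τ Ψ.compl x (unitInterval.symm t) = !decision hr τ Ψ x t := by
  have h := hτ (nbhd hr Ψ x)
  rw [decision, decision, nbhd_compl, ← decide_not, decide_eq_decide, not_lt,
    ← Subtype.coe_lt_coe, h, unitInterval.coe_symm_eq, ← Subtype.coe_le_coe]
  have ht' : (t : ℝ) ≠ τ (nbhd hr Ψ x) := fun h => ht (Subtype.ext h)
  constructor
  · intro h
    linarith
  · intro h
    rcases h.lt_or_eq with h | h
    · linarith
    · exact absurd h.symm ht'

theorem residual_symm (hr : Even r) {τ : LocalRule K r} (hτ : τ.IsBalanced) (Φ : Formula K n m)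
    (u : Fin n → unitInterval)
    (hu : ∀ i : Fin n, u i ≠ τ (nbhd hr (residual hr τ Φ.toInstance u i) i)) (i : ℕ) :
    residual hr τ Φ.toInstance (fun j => unitInterval.symm (u j)) i
      = (residual hr τ Φ.toInstance u i).compl := by
  induction i with
  | zero => exact Φ.compl_toInstance.symm
  | succ i ih =>
    rw [residual, residual]
    split_ifs with hi
    · rw [ih, decision_compl hr hτ _ _ _ (hu ⟨i, hi⟩), Instance.assign_compl]
    · exact ih

/-- For a balanced rule, reversing all the seeds complements the output. -/
theorem output_symm (hr : Even r) {τ : LocalRule K r} (hτ : τ.IsBalanced) (Φ : Formula K n m)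
    (u : Fin n → unitInterval)
    (hu : ∀ i : Fin n, u i ≠ τ (nbhd hr (residual hr τ Φ.toInstance u i) i)) (i : Fin n) :
    output hr τ Φ.toInstance (fun j => unitInterval.symm (u j)) i
      = !output hr τ Φ.toInstance u i := by
  rw [output, output, residual_symm hr hτ Φ u hu, decision_compl hr hτ _ _ _ (hu i)]

/-! ### Interpolating copies of a random assignment -/

section Seeds

/-- The seeds of `q` coupled runs: for each variable, a seed that all runs share and an own seed
for each of the runs. -/
abbrev Seeds (n q : ℕ) : Type := Fin n → unitInterval × (Fin q → unitInterval)

/-- The seeds used by the `k`-th run at stage `t`: its own ones for the first `t` variables and the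
shared ones for the others. -/
def mix (t : ℕ) (k : Fin q) (ω : Seeds n q) : Fin n → unitInterval :=
  fun i => if (i : ℕ) < t then (ω i).2 k else (ω i).1

theorem measurable_mix (t : ℕ) (k : Fin q) : Measurable (mix (n := n) t k) := by
  refine measurable_pi_lambda _ fun i => ?_
  by_cases hi : (i : ℕ) < t
  · simp only [mix, hi, if_true]
    fun_prop
  · simp only [mix, hi, if_false]
    fun_prop

/-- The seeds of `q` runs, split into the shared ones and, run by run, the own ones. -/
def splitSeeds (ω : Seeds n q) :
    (Fin n → unitInterval) × (Fin q → Fin n → unitInterval) :=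
  (fun i => (ω i).1, fun k i => (ω i).2 k)

theorem measurePreserving_swapArgs :
    MeasurePreserving (fun (w : Fin n → Fin q → unitInterval) k i => w i k) := by
  have h₁ : MeasurePreserving (MeasurableEquiv.curry (Fin n) (Fin q) unitInterval) := by
    refine ⟨MeasurableEquiv.measurable _, ?_⟩
    have := Measure.infinitePi_map_curry (ι := Fin n) (κ := Fin q)
      (fun _ _ => (volume : Measure unitInterval))
    simp only [Measure.infinitePi_eq_pi] at this
    exact this
  have h₂ : MeasurePreserving (MeasurableEquiv.curry (Fin q) (Fin n) unitInterval) := by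
    refine ⟨MeasurableEquiv.measurable _, ?_⟩
    have := Measure.infinitePi_map_curry (ι := Fin q) (κ := Fin n)
      (fun _ _ => (volume : Measure unitInterval))
    simp only [Measure.infinitePi_eq_pi] at this
    exact this
  have h₃ := volume_measurePreserving_piCongrLeft (fun _ : Fin q × Fin n => unitInterval)
    (Equiv.prodComm (Fin n) (Fin q))
  have h := (h₂.comp h₃).comp h₁.symm
  convert h using 1
  ext w k i
  exact congrArg Subtype.val (Equiv.piCongrLeft_apply_apply (fun _ : Fin q × Fin n => unitInterval)
    (Equiv.prodComm (Fin n) (Fin q)) (fun p : Fin n × Fin q => w p.1 p.2) (i, k)).symm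

theorem measurePreserving_splitSeeds :
    MeasurePreserving (splitSeeds (n := n) (q := q)) := by
  have h₁ := volume_measurePreserving_arrowProdEquivProdArrow unitInterval
    (Fin q → unitInterval) (Fin n)
  exact ((MeasurePreserving.id volume).prod measurePreserving_swapArgs).comp h₁

/-- The runs are independent given the shared seeds, so by Jensen's inequality all of
them succeed with at least the `q`-th power of the probability that one succeeds. -/
theorem pow_volume_le_volume_forall (hq : q ≠ 0) (t : ℕ) {A : Set (Fin n → unitInterval)}
    (hA : MeasurableSet A) :
    volume A ^ q ≤ volume {ω : Seeds n q | ∀ k, mix t k ω ∈ A} := by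
  let mix' : (Fin n → unitInterval) × (Fin n → unitInterval) → Fin n → unitInterval :=
    fun p i => if (i : ℕ) < t then p.2 i else p.1 i
  have hmix' : MeasurePreserving mix' := by
    have h₁ := (volume_measurePreserving_arrowProdEquivProdArrow unitInterval
      unitInterval (Fin n)).symm
    have h₂ : MeasurePreserving (fun (p : Fin n → unitInterval × unitInterval) (i : Fin n) =>
        if (i : ℕ) < t then (p i).2 else (p i).1) := by
      refine volume_preserving_pi (f := fun (i : Fin n) (p : unitInterval × unitInterval) =>
        if (i : ℕ) < t then p.2 else p.1) fun i => ?_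
      by_cases hi : (i : ℕ) < t
      · simp only [hi, if_true]
        exact measurePreserving_snd
      · simp only [hi, if_false]
        exact measurePreserving_fst
    exact h₂.comp h₁
  have hB : MeasurableSet (mix' ⁻¹' A) := hmix'.measurable hA
  set g : (Fin n → unitInterval) → ENNReal := fun U => volume (Prod.mk U ⁻¹' (mix' ⁻¹' A))
  have hg : Measurable g := measurable_measure_prodMk_left hB
  have h₁ : volume A = ∫⁻ U, g U := by
    rw [← hmix'.measure_preimage hA.nullMeasurableSet]
    exact Measure.prod_apply hB
  have h₂ : volume {ω : Seeds n q | ∀ k, mix t k ω ∈ A} = ∫⁻ U, g U ^ q := by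
    let C : Set ((Fin n → unitInterval) × (Fin q → Fin n → unitInterval)) :=
      {p | ∀ k, mix' (p.1, p.2 k) ∈ A}
    have hC : MeasurableSet C := by
      have : C = ⋂ k, (fun p : (Fin n → unitInterval) × (Fin q → Fin n → unitInterval) =>
          (p.1, p.2 k)) ⁻¹' (mix' ⁻¹' A) := by
        ext p
        simp [C]
      rw [this]
      refine MeasurableSet.iInter fun k => ?_
      exact (show Measurable fun p : (Fin n → unitInterval) × (Fin q → Fin n → unitInterval) =>
        (p.1, p.2 k) by fun_prop) hB
    have hpre : {ω : Seeds n q | ∀ k, mix t k ω ∈ A} = splitSeeds ⁻¹' C := rfl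
    rw [hpre, measurePreserving_splitSeeds.measure_preimage hC.nullMeasurableSet]
    refine (Measure.prod_apply hC).trans (lintegral_congr fun U => ?_)
    have : Prod.mk U ⁻¹' C = Set.univ.pi fun _ : Fin q => Prod.mk U ⁻¹' (mix' ⁻¹' A) := by
      ext W
      simp [C]
    rw [this]
    exact (Measure.pi_pi _ _).trans (by simp [g])
  rw [h₁, h₂]
  have h₃ := eLpNorm'_le_eLpNorm'_of_exponent_le (p := 1) (q := q) zero_lt_one
    (by exact_mod_cast Nat.one_le_iff_ne_zero.2 hq) volume hg.aestronglyMeasurable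
  have hq' : (q : ℝ) ≠ 0 := by exact_mod_cast hq
  simp only [eLpNorm', enorm_eq_self, ENNReal.rpow_one, div_one, ENNReal.rpow_natCast] at h₃
  calc _ ≤ ((∫⁻ U, g U ^ q) ^ (1 / (q : ℝ))) ^ q := by gcongr
    _ = _ := by
      rw [← ENNReal.rpow_natCast, ← ENNReal.rpow_mul, one_div, inv_mul_cancel₀ hq',
        ENNReal.rpow_one]

variable (F : (Fin n → unitInterval) → Fin n → Bool)

/-- The number of variables on which the `k`-th and the `l`-th run differ at stage `t`. -/
noncomputable def discrepancy (t : ℕ) (k l : Fin q) (ω : Seeds n q) : ℝ :=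
  ∑ j, if F (mix t k ω) j ≠ F (mix t l ω) j then 1 else 0

theorem discrepancy_eq_hammingDist (t : ℕ) (k l : Fin q) (ω : Seeds n q) :
    discrepancy F t k l ω = hammingDist (F (mix t k ω)) (F (mix t l ω)) := by
  rw [discrepancy, hammingDist, sum_boole]

variable {F}

section

variable (hF : Measurable F)
include hF

theorem measurable_disagree (t : ℕ) (k l : Fin q) (j : Fin n) : Measurable fun ω : Seeds n q =>
    if F (mix t k ω) j ≠ F (mix t l ω) j then (1 : ℝ) else 0 := by
  have h : ∀ k : Fin q, Measurable fun ω : Seeds n q => F (mix t k ω) j := fun k =>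
    (measurable_pi_apply j).comp (hF.comp (measurable_mix t k))
  refine Measurable.ite ?_ measurable_const measurable_const
  exact (measurableSet_eq_fun (h k) (h l)).compl

theorem memLp_disagree (t : ℕ) (k l : Fin q) (j : Fin n) (p : ENNReal) :
    MemLp (fun ω : Seeds n q => if F (mix t k ω) j ≠ F (mix t l ω) j then (1 : ℝ) else 0) p := by
  refine MemLp.of_bound (measurable_disagree hF t k l j).aestronglyMeasurable 1 ?_
  refine Filter.Eventually.of_forall fun ω => ?_
  split_ifs <;> simp

theorem memLp_discrepancy (t : ℕ) (k l : Fin q) (p : ENNReal) :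
    MemLp (discrepancy F t k l) p :=
  memLp_finsetSum _ fun j _ => memLp_disagree hF t k l j p

theorem integrable_discrepancy (t : ℕ) (k l : Fin q) : Integrable (discrepancy F t k l) :=
  memLp_one_iff_integrable.1 (memLp_discrepancy hF t k l 1)

end

theorem indepFun_of_disjoint {X Y : Seeds n q → ℝ} (hX : Measurable X) (hY : Measurable Y)
    (S T : Finset (Fin n)) (hST : Disjoint S T)
    (hXS : ∀ ω ω', (∀ i ∈ S, ω i = ω' i) → X ω = X ω')
    (hYT : ∀ ω ω', (∀ i ∈ T, ω i = ω' i) → Y ω = Y ω') : IndepFun X Y volume := by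
  classical
  have hind : iIndepFun (fun (i : Fin n) (ω : Seeds n q) => ω i) volume :=
    iIndepFun_pi (μ := fun _ : Fin n => (volume : Measure (unitInterval × (Fin q → unitInterval))))
      (X := fun _ => id) fun _ => aemeasurable_id
  have hind' := hind.indepFun_finset S T hST fun i => measurable_pi_apply i
  let ext : (A : Finset (Fin n)) → (A → unitInterval × (Fin q → unitInterval)) → Seeds n q :=
    fun A z i => if h : i ∈ A then z ⟨i, h⟩ else (0, fun _ => 0)
  have hext : ∀ A, Measurable (ext A) := by
    intro A
    refine measurable_pi_lambda _ fun i => ?_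
    by_cases h : i ∈ A
    · simp only [ext, h, dif_pos]
      exact measurable_pi_apply _
    · simp only [ext, h, dif_neg, not_false_iff]
      exact measurable_const
  have hX' : X = (X ∘ ext S) ∘ fun (ω : Seeds n q) (i : S) => ω i := by
    funext ω
    exact hXS _ _ fun i hi => by simp [ext, hi]
  have hY' : Y = (Y ∘ ext T) ∘ fun (ω : Seeds n q) (i : T) => ω i := by
    funext ω
    exact hYT _ _ fun i hi => by simp [ext, hi]
  rw [hX', hY']
  exact hind'.comp (hX.comp (hext S)) (hY.comp (hext T))

/-- Variables without a common influence are decided independently, so that the variance of the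
discrepancy is at most the number of pairs with a common influence. -/
theorem variance_discrepancy_le (hF : Measurable F) (D : Fin n → Fin n → Prop)
    (hD : ∀ j u u', (∀ i, D i j → u i = u' i) → F u j = F u' j) (P : Finset (Fin n × Fin n))
    (hP : ∀ i j j', D i j → D i j' → (j, j') ∈ P) (t : ℕ) (k l : Fin q) :
    variance (discrepancy F t k l) volume ≤ #P := by
  classical
  let X : Fin n → Seeds n q → ℝ := fun j ω =>
    if F (mix t k ω) j ≠ F (mix t l ω) j then 1 else 0
  have hX : ∀ j, MemLp (X j) 2 := fun j => memLp_disagree hF t k l j 2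
  have hX01 : ∀ j ω, 0 ≤ X j ω ∧ X j ω ≤ 1 := by
    intro j ω
    simp only [X]
    split_ifs <;> norm_num
  have hcongr : ∀ j (ω ω' : Seeds n q), (∀ i, D i j → ω i = ω' i) → X j ω = X j ω' := by
    intro j ω ω' h
    have hmix : ∀ k, F (mix t k ω) j = F (mix t k ω') j := fun k =>
      hD j _ _ fun i hi => by simp only [mix, h i hi]
    simp only [X, hmix]
  have hcov : ∀ j j', cov[X j, X j'; volume] ≤ if (j, j') ∈ P then 1 else 0 := by
    intro j j'
    split_ifs with hjj
    · rw [covariance_eq_sub (hX j) (hX j')]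
      have h₁ : ∫ ω, (X j * X j') ω ≤ 1 := by
        have hint : Integrable (X j * X j') := (hX j).integrable_mul (hX j')
        calc ∫ ω, (X j * X j') ω ≤ ∫ _ : Seeds n q, (1 : ℝ) :=
              integral_mono hint (integrable_const _) fun ω =>
                mul_le_one₀ (hX01 j ω).2 (hX01 j' ω).1 (hX01 j' ω).2
          _ = 1 := by simp
      have h₂ : 0 ≤ (∫ ω, X j ω) * ∫ ω, X j' ω :=
        mul_nonneg (integral_nonneg fun ω => (hX01 j ω).1) (integral_nonneg fun ω => (hX01 j' ω).1)
      linarith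
    · have : IndepFun (X j) (X j') volume := by
        refine indepFun_of_disjoint (measurable_disagree hF t k l j)
          (measurable_disagree hF t k l j') {i | D i j} {i | D i j'} ?_
          (fun ω ω' h => hcongr j ω ω' fun i hi => h i (by simpa using hi))
          (fun ω ω' h => hcongr j' ω ω' fun i hi => h i (by simpa using hi))
        rw [Finset.disjoint_left]
        intro i hi hi'
        exact hjj (hP i j j' (mem_filter.1 hi).2 (mem_filter.1 hi').2)
      rw [this.covariance_eq_zero (hX j) (hX j')]
  have hvar : variance (discrepancy F t k l) volume = ∑ j, ∑ j', cov[X j, X j'; volume] := by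
    have h : discrepancy F t k l = ∑ j, X j := by
      funext ω
      simp [discrepancy, X]
    rw [h, variance_sum hX]
  rw [hvar]
  calc _ ≤ ∑ j, ∑ j', (if (j, j') ∈ P then (1 : ℝ) else 0) :=
        sum_le_sum fun j _ => sum_le_sum fun j' _ => hcov j j'
    _ = #P := by
        rw [← Fintype.sum_prod_type' (f := fun j j' => if (j, j') ∈ P then (1 : ℝ) else 0)]
        simp

/-- The mean discrepancy of two distinct runs does not depend on the choice of the runs. -/
theorem integral_discrepancy_eq (hF : Measurable F) (t : ℕ) {k l k' l' : Fin q} (h : k ≠ l)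
    (h' : k' ≠ l') :
    ∫ ω, discrepancy F t k l ω = ∫ ω, discrepancy F t k' l' ω := by
  obtain ⟨π, hk, hl⟩ : ∃ π : Equiv.Perm (Fin q), π k = k' ∧ π l = l' := by
    refine ⟨(Equiv.swap k k').trans (Equiv.swap (Equiv.swap k k' l) l'), ?_, ?_⟩
    · rw [Equiv.trans_apply, Equiv.swap_apply_left]
      refine Equiv.swap_apply_of_ne_of_ne (fun hcon => h ?_) h'
      apply (Equiv.swap k k').injective
      rw [Equiv.swap_apply_left, ← hcon]
    · rw [Equiv.trans_apply, Equiv.swap_apply_left]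
  let T : Seeds n q → Seeds n q := fun ω i => ((ω i).1, (ω i).2 ∘ π)
  have hT : MeasurePreserving T := by
    refine volume_preserving_pi (f := fun (_ : Fin n)
      (p : unitInterval × (Fin q → unitInterval)) => (p.1, p.2 ∘ π)) fun i => ?_
    have hπ : MeasurePreserving (fun w : Fin q → unitInterval => w ∘ π) := by
      have e : (fun w : Fin q → unitInterval => w ∘ π) =
          MeasurableEquiv.piCongrLeft (fun _ : Fin q => unitInterval) π.symm := by
        funext w b
        have := Equiv.piCongrLeft_apply_apply (fun _ : Fin q => unitInterval) π.symm w (π b)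
        rw [Equiv.symm_apply_apply] at this
        exact this.symm
      rw [e]
      exact volume_measurePreserving_piCongrLeft (fun _ : Fin q => unitInterval) π.symm
    exact (MeasurePreserving.id volume).prod hπ
  have hcomp : ∀ ω, discrepancy F t k l (T ω) = discrepancy F t k' l' ω := by
    intro ω
    have hmix : ∀ k, mix t k (T ω) = mix t (π k) ω := fun k => rfl
    simp only [discrepancy, hmix, hk, hl]
  rw [← integral_congr_ae (Filter.Eventually.of_forall hcomp)]
  conv_lhs => rw [← hT.map_eq]
  exact integral_map hT.aemeasurable
    (hT.map_eq.symm ▸ (integrable_discrepancy hF t k l).aestronglyMeasurable)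

theorem integral_discrepancy_zero (k l : Fin q) : ∫ ω, discrepancy F 0 k l ω = 0 := by
  have : ∀ ω, discrepancy F 0 k l ω = 0 := fun ω => by
    have hmix : mix 0 k ω = mix 0 l ω := by
      funext i
      simp [mix]
    simp [discrepancy, hmix]
  simp [this]

theorem measurePreserving_mix_last (k : Fin q) : MeasurePreserving (mix (n := n) n k) := by
  have h : mix (n := n) n k = fun (ω : Seeds n q) i => (ω i).2 k := by
    funext ω i
    simp [mix]
  rw [h]
  refine volume_preserving_pi (f := fun (_ : Fin n)
    (p : unitInterval × (Fin q → unitInterval)) => p.2 k) fun i => ?_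
  exact (measurePreserving_eval (fun _ : Fin q => (volume : Measure unitInterval)) k).comp
    measurePreserving_snd

/-- Two independent runs differ on half of the variables on average: reversing the seeds of
one of them exchanges agreement and disagreement. -/
theorem integral_discrepancy_last (hF : Measurable F)
    (hsymm : ∀ᵐ u : Fin n → unitInterval, ∀ j, F (fun i => unitInterval.symm (u i)) j = !F u j)
    {k l : Fin q} (hkl : k ≠ l) : ∫ ω, discrepancy F n k l ω = n / 2 := by
  let T : Seeds n q → Seeds n q := fun ω i =>
    ((ω i).1, fun k => if k = l then unitInterval.symm ((ω i).2 k) else (ω i).2 k)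
  have hT : MeasurePreserving T := by
    refine volume_preserving_pi (f := fun (_ : Fin n)
      (p : unitInterval × (Fin q → unitInterval)) =>
        (p.1, fun k => if k = l then unitInterval.symm (p.2 k) else p.2 k)) fun i => ?_
    refine (MeasurePreserving.id volume).prod (volume_preserving_pi
      (f := fun (k : Fin q) (s : unitInterval) => if k = l then unitInterval.symm s else s)
      fun k => ?_)
    by_cases h : k = l
    · simp only [h, if_true]
      exact unitInterval.measurePreserving_symm
    · simp only [h, if_false]
      exact MeasurePreserving.id volume
  have hae : ∀ᵐ ω : Seeds n q, discrepancy F n k l (T ω) = n - discrepancy F n k l ω := by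
    filter_upwards [(measurePreserving_mix_last l).quasiMeasurePreserving.ae hsymm] with ω hω
    have hk : mix n k (T ω) = mix n k ω := by
      funext i
      simp [mix, T, hkl]
    have hl : mix n l (T ω) = fun i => unitInterval.symm (mix n l ω i) := by
      funext i
      simp [mix, T]
    have hsum : discrepancy F n k l (T ω) + discrepancy F n k l ω = n := by
      simp only [discrepancy]
      rw [← sum_add_distrib]
      calc _ = ∑ _ : Fin n, (1 : ℝ) := by
            refine sum_congr rfl fun j _ => ?_
            rw [hk, hl, hω j]
            cases F (mix n k ω) j <;> cases F (mix n l ω) j <;> simp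
        _ = n := by simp
    linarith
  have h₁ : ∫ ω, discrepancy F n k l (T ω) = ∫ ω, discrepancy F n k l ω := by
    conv_rhs => rw [← hT.map_eq]
    exact (integral_map hT.aemeasurable
      (hT.map_eq.symm ▸ (integrable_discrepancy hF n k l).aestronglyMeasurable)).symm
  rw [integral_congr_ae hae, integral_sub (integrable_const _) (integrable_discrepancy hF n k l)]
    at h₁
  simp at h₁
  linarith

/-- Moving from one stage to the next changes a single seed of each run. -/
theorem abs_integral_discrepancy_succ_sub_le (hF : Measurable F) (D : Fin n → Fin n → Prop)
    (hD : ∀ j u u', (∀ i, D i j → u i = u' i) → F u j = F u' j) (P : Finset (Fin n × Fin n))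
    (hP : ∀ i j j', D i j → D i j' → (j, j') ∈ P) {t : ℕ} (ht : t < n) (k l : Fin q) :
    |(∫ ω, discrepancy F (t + 1) k l ω) - ∫ ω, discrepancy F t k l ω| ≤ 2 * √(#P : ℝ) := by
  classical
  let O : Finset (Fin n) := {j | D ⟨t, ht⟩ j}
  have hO : (#O : ℝ) ≤ √(#P : ℝ) := by
    refine Real.le_sqrt_of_sq_le ?_
    have : #(O ×ˢ O) ≤ #P := by
      refine card_le_card fun p hp => ?_
      obtain ⟨h₁, h₂⟩ := mem_product.1 hp
      exact hP _ _ _ (mem_filter.1 h₁).2 (mem_filter.1 h₂).2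
    rw [card_product] at this
    rw [sq]
    exact_mod_cast this
  have hrun : ∀ (k : Fin q) (ω : Seeds n q),
      hammingDist (F (mix (t + 1) k ω)) (F (mix t k ω)) ≤ #O := by
    intro k ω
    refine card_le_card fun j hj => mem_filter.2 ⟨mem_univ _, ?_⟩
    by_contra hcon
    refine (mem_filter.1 hj).2 (hD j _ _ fun i hi => ?_)
    have hit : (i : ℕ) ≠ t := by
      rintro rfl
      exact hcon hi
    have hiff : (i : ℕ) < t + 1 ↔ (i : ℕ) < t := by omega
    simp only [mix, hiff]
  have hpt : ∀ ω : Seeds n q, |discrepancy F (t + 1) k l ω - discrepancy F t k l ω| ≤ 2 * #O := by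
    intro ω
    have h₁ := hrun k ω
    have h₂ := hrun l ω
    have h₃ := hammingDist_triangle (F (mix (t + 1) k ω)) (F (mix t k ω)) (F (mix t l ω))
    have h₄ := hammingDist_triangle (F (mix (t + 1) k ω)) (F (mix t l ω)) (F (mix (t + 1) l ω))
    have h₅ := hammingDist_triangle (F (mix t k ω)) (F (mix (t + 1) k ω)) (F (mix t l ω))
    have h₆ := hammingDist_triangle (F (mix (t + 1) k ω)) (F (mix (t + 1) l ω)) (F (mix t l ω))
    rw [hammingDist_comm (F (mix t l ω)) (F (mix (t + 1) l ω))] at h₄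
    rw [hammingDist_comm (F (mix t k ω)) (F (mix (t + 1) k ω))] at h₅
    rw [discrepancy_eq_hammingDist, discrepancy_eq_hammingDist, abs_le]
    constructor
    · have : hammingDist (F (mix t k ω)) (F (mix t l ω)) ≤
          hammingDist (F (mix (t + 1) k ω)) (F (mix (t + 1) l ω)) + 2 * #O := by omega
      have : (hammingDist (F (mix t k ω)) (F (mix t l ω)) : ℝ) ≤
          hammingDist (F (mix (t + 1) k ω)) (F (mix (t + 1) l ω)) + 2 * #O := by
        exact_mod_cast this
      linarith
    · have : hammingDist (F (mix (t + 1) k ω)) (F (mix (t + 1) l ω)) ≤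
          hammingDist (F (mix t k ω)) (F (mix t l ω)) + 2 * #O := by omega
      have : (hammingDist (F (mix (t + 1) k ω)) (F (mix (t + 1) l ω)) : ℝ) ≤
          hammingDist (F (mix t k ω)) (F (mix t l ω)) + 2 * #O := by
        exact_mod_cast this
      linarith
  rw [← integral_sub (integrable_discrepancy hF _ k l) (integrable_discrepancy hF _ k l)]
  have h := norm_integral_le_of_norm_le_const (μ := (volume : Measure (Seeds n q)))
    (f := fun ω => discrepancy F (t + 1) k l ω - discrepancy F t k l ω)
    (C := 2 * #O) (Filter.Eventually.of_forall hpt)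
  rw [Real.norm_eq_abs, probReal_univ, mul_one] at h
  linarith

/-- If no `q` assignments in `S` have all their pairwise distances in `[a, b]`, then the random
assignment is unlikely to belong to `S`: at the stage at which the mean discrepancy of two runs is
the middle of `[a, b]`, the runs cannot all end in `S` unless some discrepancy is far from its
mean. -/
theorem pow_volume_le_of_no_tuple (hF : Measurable F) (D : Fin n → Fin n → Prop)
    (hD : ∀ j u u', (∀ i, D i j → u i = u' i) → F u j = F u' j) (P : Finset (Fin n × Fin n))
    (hP : ∀ i j j', D i j → D i j' → (j, j') ∈ P)
    (hsymm : ∀ᵐ u : Fin n → unitInterval, ∀ j, F (fun i => unitInterval.symm (u i)) j = !F u j)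
    (hq : 2 ≤ q) (S : Set (Fin n → Bool)) {a b : ℝ} (ha : 0 ≤ a) (hab : a < b) (hb : a + b ≤ n)
    (hS : ∀ s : Fin q → Fin n → Bool, (∀ k, s k ∈ S) →
      ∃ k l, k ≠ l ∧ (hammingDist (s k) (s l) : ℝ) ∉ Set.Icc a b)
    (hstep : 2 * √(#P : ℝ) ≤ (b - a) / 4) :
    volume {u | F u ∈ S} ^ q ≤ ENNReal.ofReal (q ^ 2 * (#P / ((b - a) / 4) ^ 2)) := by
  classical
  let k₀ : Fin q := ⟨0, by omega⟩
  let l₀ : Fin q := ⟨1, by omega⟩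
  have hkl₀ : k₀ ≠ l₀ := by simp [k₀, l₀]
  let f : ℕ → ℝ := fun t => ∫ ω, discrepancy F t k₀ l₀ ω
  set c := (b - a) / 4
  have hc : 0 < c := by simp only [c]; linarith
  obtain ⟨t, ht⟩ : ∃ t, |f t - (a + b) / 2| ≤ c := by
    have hex : ∃ t, (a + b) / 2 ≤ f t := by
      refine ⟨n, ?_⟩
      simp only [f]
      rw [integral_discrepancy_last hF hsymm hkl₀]
      linarith
    -- The first stage at which the mean discrepancy exceeds the middle of the interval.
    have h₁ : (a + b) / 2 ≤ f (Nat.find hex) := Nat.find_spec hex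
    have hle : Nat.find hex ≤ n := by
      refine Nat.find_min' hex ?_
      simp only [f]
      rw [integral_discrepancy_last hF hsymm hkl₀]
      linarith
    refine ⟨Nat.find hex, ?_⟩
    rw [abs_of_nonneg (by linarith)]
    have hpos : Nat.find hex ≠ 0 := by
      intro h0
      rw [h0] at h₁
      simp only [f, integral_discrepancy_zero] at h₁
      linarith
    obtain ⟨s, hs⟩ := Nat.exists_eq_succ_of_ne_zero hpos
    have h₂ : f s < (a + b) / 2 := not_le.1 (Nat.find_min hex (by omega))
    have h₃ := (abs_le.1 (abs_integral_discrepancy_succ_sub_le hF D hD P hP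
      (show s < n by omega) k₀ l₀)).2
    rw [hs]
    change f (s + 1) - f s ≤ _ at h₃
    change f (s + 1) - _ ≤ _
    linarith
  have hA : MeasurableSet {u | F u ∈ S} := hF (Set.toFinite S).measurableSet
  refine (pow_volume_le_volume_forall (by omega) t hA).trans ?_
  have hsub : {ω : Seeds n q | ∀ k, mix t k ω ∈ {u | F u ∈ S}} ⊆
      ⋃ p ∈ (univ : Finset (Fin q)).offDiag,
        {ω | c ≤ |discrepancy F t p.1 p.2 ω - ∫ ω, discrepancy F t p.1 p.2 ω|} := by
    intro ω hω
    obtain ⟨k, l, hkl, hdist⟩ := hS (fun k => F (mix t k ω)) hω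
    refine Set.mem_iUnion₂.2 ⟨(k, l), by simpa using hkl, ?_⟩
    change c ≤ _
    by_contra hcon
    refine hdist ?_
    rw [← discrepancy_eq_hammingDist]
    simp only [not_le] at hcon
    rw [integral_discrepancy_eq hF t hkl hkl₀] at hcon
    have h₁ := abs_lt.1 hcon
    have h₂ := abs_le.1 ht
    change -c < _ - f t ∧ _ - f t < c at h₁
    constructor <;> simp only [c] at h₁ h₂ <;> linarith [h₁.1, h₁.2, h₂.1, h₂.2]
  calc _ ≤ ∑ p ∈ (univ : Finset (Fin q)).offDiag,
        volume {ω | c ≤ |discrepancy F t p.1 p.2 ω - ∫ ω, discrepancy F t p.1 p.2 ω|} :=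
        (measure_mono hsub).trans (measure_biUnion_finset_le _ _)
    _ ≤ ∑ p ∈ (univ : Finset (Fin q)).offDiag, ENNReal.ofReal (#P / c ^ 2) := by
        refine sum_le_sum fun p _ => ?_
        refine (meas_ge_le_variance_div_sq (memLp_discrepancy hF t p.1 p.2 2) hc).trans ?_
        gcongr
        exact variance_discrepancy_le hF D hD P hP t p.1 p.2
    _ ≤ _ := by
        rw [sum_const, offDiag_card, card_univ, Fintype.card_fin,
          ENNReal.ofReal_mul (by positivity), nsmul_eq_mul]
        gcongr
        rw [← ENNReal.ofReal_natCast]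
        refine ENNReal.ofReal_le_ofReal ?_
        rw [sq]
        exact_mod_cast Nat.sub_le _ _

end Seeds

/-! ### The output as a random assignment -/

theorem measurable_output (hr : Even r) (τ : LocalRule K r) (Φ : Formula K n m) :
    Measurable fun u : Fin n → unitInterval => output hr τ Φ.toInstance u := by
  classical
  refine measurable_pi_iff.2 fun j => ?_
  induction j using WellFoundedLT.induction with
  | ind j ih =>
    refine measurable_to_bool ?_
    -- The threshold for the seed of `j` is a function of the previous values.
    have hset : (fun u : Fin n → unitInterval => output hr τ Φ.toInstance u j) ⁻¹' {true} =
        ⋃ s : Fin n → Bool, (⋂ i : Fin n, ⋂ _ : i < j, {u | output hr τ Φ.toInstance u i = s i}) ∩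
          {u | u j < τ (nbhd hr (assignedInstance Φ (extendAssignment s) j) j)} := by
      ext u
      have h : ∀ s : Fin n → Bool, (∀ i < j, output hr τ Φ.toInstance u i = s i) →
          output hr τ Φ.toInstance u j =
            decision hr τ (assignedInstance Φ (extendAssignment s) j) j (u j) := by
        intro s hs
        rw [output, residual_toInstance]
        refine decision_assignedInstance_congr hr τ _ fun v hv _ => ?_
        simpa [extendAssignment] using hs v hv
      simp only [Set.mem_preimage, Set.mem_singleton_iff, Set.mem_iUnion, Set.mem_inter_iff,
        Set.mem_iInter, Set.mem_ofPred_eq]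
      constructor
      · intro hu
        refine ⟨output hr τ Φ.toInstance u, fun i _ => rfl, ?_⟩
        rw [h _ fun i _ => rfl] at hu
        simpa [decision] using hu
      · rintro ⟨s, hs, hu⟩
        rw [h s hs]
        simpa [decision] using hu
    rw [hset]
    refine MeasurableSet.iUnion fun s => MeasurableSet.inter ?_ ?_
    · refine MeasurableSet.iInter fun i => MeasurableSet.iInter fun hi => ?_
      exact measurableSet_eq_fun (ih i hi) measurable_const
    · exact measurableSet_lt (measurable_pi_apply j) measurable_const

theorem ae_output_symm (hr : Even r) {τ : LocalRule K r} (hτ : τ.IsBalanced) (Φ : Formula K n m) :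
    ∀ᵐ u : Fin n → unitInterval, ∀ j, output hr τ Φ.toInstance (fun i => unitInterval.symm (u i)) j
      = !output hr τ Φ.toInstance u j := by
  have h : ∀ᵐ u : Fin n → unitInterval, ∀ (i : Fin n) (s : Fin n → Bool),
      u i ≠ τ (nbhd hr (assignedInstance Φ (extendAssignment s) i) i) := by
    refine ae_all_iff.2 fun i => ae_all_iff.2 fun s => ?_
    have h₁ : ∀ᵐ t : unitInterval,
        t ≠ τ (nbhd hr (assignedInstance Φ (extendAssignment s) i) i) :=
      compl_mem_ae_iff.2 (measure_singleton _)
    exact (measurePreserving_eval (fun _ : Fin n => (volume : Measure unitInterval)) i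
      ).quasiMeasurePreserving.ae h₁
  filter_upwards [h] with u hu
  refine output_symm hr hτ Φ u fun i => ?_
  rw [residual_toInstance]
  exact hu i _

/-- For a formula without `q` satisfying assignments whose pairwise distances all lie in `[a, b]`,
and with few correlated pairs of variables, the algorithm is unlikely to succeed. -/
theorem pow_volume_isSatisfiedBy_le (hr : Even r) {τ : LocalRule K r} (hτ : τ.IsBalanced)
    (Φ : Formula K n m) (hq : 2 ≤ q) {a b : ℝ} (ha : 0 ≤ a) (hab : a < b) (hb : a + b ≤ n)
    (hΦ : ∀ s : Fin q → Fin n → Bool, (∀ k, Φ.IsSatisfiedBy (s k)) →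
      ∃ k l, k ≠ l ∧ (hammingDist (s k) (s l) : ℝ) ∉ Set.Icc a b)
    (hstep : 2 * √(#(correlatedPairs Φ r) : ℝ) ≤ (b - a) / 4) :
    volume {u | Φ.IsSatisfiedBy (output hr τ Φ.toInstance u)} ^ q ≤
      ENNReal.ofReal (q ^ 2 * (#(correlatedPairs Φ r) / ((b - a) / 4) ^ 2)) := by
  refine pow_volume_le_of_no_tuple (F := fun u => output hr τ Φ.toInstance u)
    (measurable_output hr τ Φ) (Influences Φ r)
    (fun j u u' h => output_congr hr τ Φ j h) (correlatedPairs Φ r) ?_ (ae_output_symm hr hτ Φ) hq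
    {σ | Φ.IsSatisfiedBy σ} ha hab hb hΦ hstep
  intro i j j' hj hj'
  classical
  exact mem_filter.2 ⟨mem_univ _, i, hj, hj'⟩

/-! ### Tuples of satisfying assignments at prescribed distances -/

/-- The clause has a literal of each value under `σ`. -/
def Clause.IsSatisfiedBy (C : Clause K n) (σ : Fin n → Bool) : Prop :=
  (∃ k, C.litValue σ k = true) ∧ ∃ k, C.litValue σ k = false

theorem Clause.not_isSatisfiedBy_iff {C : Clause K n} {σ : Fin n → Bool} :
    ¬ C.IsSatisfiedBy σ ↔ ∃ c, C.2 = fun k => xor (σ (C.1 k)) c := by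
  simp only [Clause.IsSatisfiedBy, Clause.litValue, not_and_or, not_exists, Bool.exists_bool,
    funext_iff]
  refine or_congr (forall_congr' fun k => ?_) (forall_congr' fun k => ?_)
  · cases σ (C.1 k) <;> cases C.2 k <;> simp
  · cases σ (C.1 k) <;> cases C.2 k <;> simp

theorem expect_clause_eq (g : Clause K n → ℝ) :
    𝔼 C, g C = 𝔼 e : Fin K ↪ Fin n, 𝔼 f : Fin K → Bool, g (e, f) := by
  rw [← expect_product' univ univ (fun (e : Fin K ↪ Fin n) (f : Fin K → Bool) => g (e, f))]
  rfl

open Classical in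
theorem expect_not_isSatisfiedBy_flags (hK : K ≠ 0) (e : Fin K ↪ Fin n) (σ : Fin n → Bool) :
    𝔼 f : Fin K → Bool, (if ¬ Clause.IsSatisfiedBy (e, f) σ then (1 : ℝ) else 0) = 2 / 2 ^ K := by
  rw [Fintype.expect_eq_sum_div_card, sum_boole]
  have h : ({f | ¬ Clause.IsSatisfiedBy (e, f) σ} : Finset (Fin K → Bool)) =
      univ.image fun (c : Bool) k => xor (σ (e k)) c := by
    ext f
    simp only [mem_filter, mem_univ, true_and, mem_image]
    exact (Clause.not_isSatisfiedBy_iff (C := (e, f))).trans (exists_congr fun c => eq_comm)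
  rw [h, card_image_of_injective]
  · simp
  · intro c c' hcc
    have := congrFun hcc ⟨0, Nat.pos_of_ne_zero hK⟩
    simpa using this

theorem descFactorial_mul_pow_le {t : ℕ} (htn : t ≤ n) (K : ℕ) :
    t.descFactorial K * n ^ K ≤ t ^ K * n.descFactorial K := by
  induction K with
  | zero => simp
  | succ K ih =>
    rw [Nat.descFactorial_succ, Nat.descFactorial_succ, pow_succ, pow_succ]
    have h : (t - K) * n ≤ t * (n - K) := by
      rcases le_total t K with h | h
      · simp [Nat.sub_eq_zero_of_le h]
      · zify [h, h.trans htn]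
        nlinarith [Nat.zero_le K, (by exact_mod_cast htn : (t : ℤ) ≤ n)]
    calc _ = (t.descFactorial K * n ^ K) * ((t - K) * n) := by ring
      _ ≤ (t ^ K * n.descFactorial K) * (t * (n - K)) := Nat.mul_le_mul ih h
      _ = _ := by ring

open Classical in
/-- Sampling without replacement hits a set `K` times with at most the probability for sampling
with replacement. -/
theorem expect_embedding_mem_le (hK : K ≤ n) (T : Finset (Fin n)) :
    𝔼 e : Fin K ↪ Fin n, (if ∀ k, e k ∈ T then (1 : ℝ) else 0) ≤ ((#T : ℝ) / n) ^ K := by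
  rw [Fintype.expect_eq_sum_div_card, sum_boole, Fintype.card_embedding_eq, Fintype.card_fin,
    Fintype.card_fin]
  have h₁ : #({e : Fin K ↪ Fin n | ∀ k, e k ∈ T} : Finset _) ≤ (#T).descFactorial K := by
    have : Fintype.card (Fin K ↪ T) = (#T).descFactorial K := by
      rw [Fintype.card_embedding_eq]
      simp
    rw [← this, ← Fintype.card_subtype]
    refine Fintype.card_le_of_injective
      (fun e : {e : Fin K ↪ Fin n // ∀ k, e k ∈ T} =>
        (⟨fun k => ⟨e.1 k, e.2 k⟩, fun k l h => e.1.injective (Subtype.ext_iff.1 h)⟩ :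
          Fin K ↪ T)) ?_
    intro e e' h
    refine Subtype.ext (Function.Embedding.ext fun k => ?_)
    exact congrArg (fun g : Fin K ↪ T => (g k : Fin n)) h
  have hT : #T ≤ n := by simpa using card_le_univ T
  have h₂ := descFactorial_mul_pow_le hT K
  have hpos : 0 < n.descFactorial K := Nat.descFactorial_pos.2 hK
  rcases Nat.eq_zero_or_pos n with rfl | hn
  · obtain rfl : K = 0 := by omega
    simp only [Nat.descFactorial_zero, Nat.cast_one, div_one, pow_zero]
    exact_mod_cast h₁.trans (by simp)
  · rw [div_pow, div_le_div_iff₀ (by exact_mod_cast hpos) (by positivity)]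
    calc _ ≤ (((#T).descFactorial K : ℕ) : ℝ) * (n : ℝ) ^ K := by gcongr
      _ ≤ _ := by exact_mod_cast h₂

open Classical in
/-- Two assignments that both violate a clause agree on all of its variables or on none. -/
theorem expect_not_isSatisfiedBy_and_le (hK0 : K ≠ 0) (hK : K ≤ n) (σ σ' : Fin n → Bool) :
    𝔼 C : Clause K n, (if ¬ C.IsSatisfiedBy σ ∧ ¬ C.IsSatisfiedBy σ' then (1 : ℝ) else 0) ≤
      2 / 2 ^ K * (((hammingDist σ σ' : ℝ) / n) ^ K + (1 - (hammingDist σ σ' : ℝ) / n) ^ K) := by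
  let T : Finset (Fin n) := {j | σ j ≠ σ' j}
  have hT : #T = hammingDist σ σ' := rfl
  have hn : (n : ℝ) ≠ 0 := by
    have : n ≠ 0 := by omega
    exact_mod_cast this
  have hTc : ((#Tᶜ : ℕ) : ℝ) / n = 1 - (hammingDist σ σ' : ℝ) / n := by
    rw [card_compl, Fintype.card_fin, Nat.cast_sub (by simpa using card_le_univ T), hT, sub_div,
      div_self hn]
  have hpt : ∀ (e : Fin K ↪ Fin n) (f : Fin K → Bool),
      (if ¬ Clause.IsSatisfiedBy (e, f) σ ∧ ¬ Clause.IsSatisfiedBy (e, f) σ' then (1 : ℝ) else 0) ≤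
      (if ¬ Clause.IsSatisfiedBy (e, f) σ then (1 : ℝ) else 0) *
        ((if ∀ k, e k ∈ T then (1 : ℝ) else 0) + (if ∀ k, e k ∈ Tᶜ then (1 : ℝ) else 0)) := by
    intro e f
    by_cases h : ¬ Clause.IsSatisfiedBy (e, f) σ ∧ ¬ Clause.IsSatisfiedBy (e, f) σ'
    · rw [if_pos h, if_pos h.1, one_mul]
      obtain ⟨c, hc⟩ := Clause.not_isSatisfiedBy_iff.1 h.1
      obtain ⟨c', hc'⟩ := Clause.not_isSatisfiedBy_iff.1 h.2
      have hk : ∀ k, xor (σ (e k)) c = xor (σ' (e k)) c' := fun k =>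
        (congrFun hc k).symm.trans (congrFun hc' k)
      have h0 : ∀ (p : Prop) [Decidable p], (0 : ℝ) ≤ if p then 1 else 0 := fun p _ => by
        split_ifs <;> norm_num
      by_cases hcc : c = c'
      · subst hcc
        have hall : ∀ k, e k ∈ Tᶜ := fun k => by simpa [T] using hk k
        rw [if_pos hall]
        linarith [h0 (∀ k, e k ∈ T)]
      · have hall : ∀ k, e k ∈ T := fun k => by
          have := hk k
          simp only [T, mem_filter, mem_univ, true_and]
          intro heq
          rw [heq] at this
          exact hcc (by simpa using this)
        rw [if_pos hall]
        linarith [h0 (∀ k, e k ∈ Tᶜ)]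
    · rw [if_neg h]
      positivity
  have : Nonempty (Fin K ↪ Fin n) := ⟨Fin.castLEEmb hK⟩
  rw [expect_clause_eq]
  calc _ ≤ 𝔼 e : Fin K ↪ Fin n, 2 / 2 ^ K *
        ((if ∀ k, e k ∈ T then (1 : ℝ) else 0) + (if ∀ k, e k ∈ Tᶜ then (1 : ℝ) else 0)) := by
        refine expect_le_expect fun e _ => ?_
        refine (expect_le_expect fun f _ => hpt e f).trans (le_of_eq ?_)
        rw [← expect_mul, expect_not_isSatisfiedBy_flags hK0]
    _ ≤ _ := by
        rw [← mul_expect, expect_add_distrib, ← hTc, ← hT]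
        gcongr
        · exact expect_embedding_mem_le hK T
        · exact expect_embedding_mem_le hK Tᶜ

open Classical in
/-- By inclusion–exclusion, assignments at pairwise distances for which two of them are
rarely violated by the same clause are all satisfied by a random clause with probability at
most `1 - 2 ^ (1 - K) (q - q² / K)`. -/
theorem expect_forall_isSatisfiedBy_le (hK0 : K ≠ 0) (hK : K ≤ n) (s : Fin q → Fin n → Bool)
    (hs : ∀ k l, k ≠ l → ((hammingDist (s k) (s l) : ℝ) / n) ^ K
      + (1 - (hammingDist (s k) (s l) : ℝ) / n) ^ K ≤ 2 / K) :
    𝔼 C : Clause K n, (if ∀ k, C.IsSatisfiedBy (s k) then (1 : ℝ) else 0) ≤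
      1 - 2 / 2 ^ K * (q - q ^ 2 / K) := by
  have := Clause.nonempty hK
  have hpt : ∀ C : Clause K n, (if ∀ k, C.IsSatisfiedBy (s k) then (1 : ℝ) else 0) ≤
      1 - ∑ k, (if ¬ C.IsSatisfiedBy (s k) then (1 : ℝ) else 0)
        + (∑ p ∈ (univ : Finset (Fin q)).offDiag,
          if ¬ C.IsSatisfiedBy (s p.1) ∧ ¬ C.IsSatisfiedBy (s p.2) then (1 : ℝ) else 0) / 2 := by
    intro C
    let V : Finset (Fin q) := {k | ¬ C.IsSatisfiedBy (s k)}
    have h₁ : ∑ k, (if ¬ C.IsSatisfiedBy (s k) then (1 : ℝ) else 0) = #V := by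
      rw [sum_boole]
    have h₂ : (∑ p ∈ (univ : Finset (Fin q)).offDiag,
        if ¬ C.IsSatisfiedBy (s p.1) ∧ ¬ C.IsSatisfiedBy (s p.2) then (1 : ℝ) else 0)
          = (#V : ℝ) * #V - #V := by
      rw [sum_boole]
      have : ({p ∈ (univ : Finset (Fin q)).offDiag |
          ¬ C.IsSatisfiedBy (s p.1) ∧ ¬ C.IsSatisfiedBy (s p.2)} : Finset _) = V.offDiag := by
        ext p
        simp only [V, mem_filter, mem_offDiag, mem_univ, true_and]
        tauto
      rw [this, offDiag_card, Nat.cast_sub (Nat.le_mul_self _)]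
      push_cast
      rfl
    rw [h₁, h₂]
    by_cases h : ∀ k, C.IsSatisfiedBy (s k)
    · have hV : V = ∅ := by
        simpa [V, filter_eq_empty_iff] using h
      rw [if_pos h, hV]
      simp
    · have hV : 1 ≤ #V := by
        push Not at h
        obtain ⟨k, hk⟩ := h
        exact card_pos.2 ⟨k, by simpa [V] using hk⟩
      rw [if_neg h]
      rcases hV.eq_or_lt with h1 | h2
      · rw [← h1]
        norm_num
      · have h2' : (2 : ℝ) ≤ #V := by exact_mod_cast h2
        nlinarith
  calc _ ≤ _ := expect_le_expect fun C _ => hpt C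
    _ = 1 - ∑ k, 𝔼 C : Clause K n, (if ¬ C.IsSatisfiedBy (s k) then (1 : ℝ) else 0)
        + (∑ p ∈ (univ : Finset (Fin q)).offDiag, 𝔼 C : Clause K n,
          if ¬ C.IsSatisfiedBy (s p.1) ∧ ¬ C.IsSatisfiedBy (s p.2) then (1 : ℝ) else 0) / 2 := by
        rw [expect_add_distrib, expect_sub_distrib, Fintype.expect_const, ← expect_div,
          expect_sum_comm, expect_sum_comm]
    _ ≤ 1 - ∑ _k : Fin q, (2 / 2 ^ K : ℝ)
        + (∑ p ∈ (univ : Finset (Fin q)).offDiag, 2 / 2 ^ K * (2 / K : ℝ)) / 2 := by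
        gcongr with k _ p hp
        · rw [expect_clause_eq]
          have : Nonempty (Fin K ↪ Fin n) := ⟨Fin.castLEEmb hK⟩
          simp only [expect_not_isSatisfiedBy_flags hK0]
          rw [Fintype.expect_const]
        · refine (expect_not_isSatisfiedBy_and_le hK0 hK _ _).trans ?_
          gcongr
          exact hs _ _ (mem_offDiag.1 hp).2.2
    _ ≤ _ := by
        rw [sum_const, sum_const, offDiag_card, card_univ, Fintype.card_fin, nsmul_eq_mul,
          nsmul_eq_mul, Nat.cast_sub (Nat.le_mul_self q)]
        have h : 0 ≤ (q : ℝ) * (2 / 2 ^ K * (2 / K)) := by positivity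
        push_cast
        have e : (1 : ℝ) - 2 / 2 ^ K * (q - q ^ 2 / K) = 1 - q * (2 / 2 ^ K)
          + (q * q * (2 / 2 ^ K * (2 / K))) / 2 := by ring
        rw [e]
        linarith

open Classical in
/-- The volume of a Hamming ball of radius `β n` is at most `exp (n β (1 - log β))`. -/
theorem card_hammingBall_le (σ₀ : Fin n → Bool) {β : ℝ} (hβ : 0 < β) (hβ1 : β ≤ 1) :
    (#{σ : Fin n → Bool | (hammingDist σ₀ σ : ℝ) ≤ β * n} : ℝ)
      ≤ Real.exp (n * (β * (1 - Real.log β))) := by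
  have hgen : ∑ σ : Fin n → Bool, β ^ hammingDist σ₀ σ = (1 + β) ^ n := by
    have h₁ : ∀ σ : Fin n → Bool, β ^ hammingDist σ₀ σ = ∏ i, if σ₀ i ≠ σ i then β else 1 := by
      intro σ
      rw [prod_ite, prod_const_one, mul_one, prod_const]
      rfl
    simp_rw [h₁]
    rw [← Fintype.prod_sum (fun i b => if σ₀ i ≠ b then β else (1 : ℝ))]
    have h₂ : ∀ i, (∑ b, if σ₀ i ≠ b then β else (1 : ℝ)) = 1 + β := by
      intro i
      cases σ₀ i <;> simp [add_comm]
    rw [prod_congr rfl fun i _ => h₂ i]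
    simp
  have hlow : (#{σ : Fin n → Bool | (hammingDist σ₀ σ : ℝ) ≤ β * n} : ℝ)
      * Real.exp (β * n * Real.log β) ≤ (1 + β) ^ n := by
    rw [← hgen, ← nsmul_eq_mul, ← sum_const]
    refine (sum_le_sum fun σ hσ => ?_).trans
      (sum_le_sum_of_subset_of_nonneg (subset_univ _) fun σ _ _ => by positivity)
    have hσ' : (hammingDist σ₀ σ : ℝ) ≤ β * n := (mem_filter.1 hσ).2
    rw [← Real.exp_log (pow_pos hβ _), Real.log_pow]
    refine Real.exp_le_exp.2 (mul_le_mul_of_nonpos_right hσ' (Real.log_nonpos hβ.le hβ1))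
  have hup : (1 + β) ^ n ≤ Real.exp (n * β) := by
    rw [Real.exp_nat_mul]
    gcongr
    rw [add_comm]
    exact Real.add_one_le_exp β
  have e : Real.exp (n * (β * (1 - Real.log β)))
      = Real.exp (n * β) * Real.exp (-(β * n * Real.log β)) := by
    rw [← Real.exp_add]
    congr 1
    ring
  rw [e, Real.exp_neg, ← div_eq_mul_inv, le_div_iff₀ (Real.exp_pos _)]
  exact hlow.trans hup

open Classical in
/-- The first assignment is arbitrary, and the others lie in a Hamming ball around it. -/
theorem card_tuples_le {p : ℕ} {a β : ℝ} (hβ : 0 < β) (hβ1 : β ≤ 1) :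
    (#{s : Fin (p + 1) → Fin n → Bool | ∀ k l, k ≠ l →
      (hammingDist (s k) (s l) : ℝ) ∈ Set.Icc a (β * n)} : ℝ)
      ≤ Real.exp (n * (Real.log 2 + p * (β * (1 - Real.log β)))) := by
  let ball : (Fin n → Bool) → Finset (Fin n → Bool) := fun σ₀ =>
    {σ | (hammingDist σ₀ σ : ℝ) ≤ β * n}
  have hsub : ({s : Fin (p + 1) → Fin n → Bool | ∀ k l, k ≠ l →
      (hammingDist (s k) (s l) : ℝ) ∈ Set.Icc a (β * n)} : Finset _) ⊆
      univ.biUnion fun σ₀ => (Fintype.piFinset fun _ : Fin p => ball σ₀).image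
        (Fin.cons (α := fun _ => Fin n → Bool) σ₀) := by
    intro s hs
    have hs' := (mem_filter.1 hs).2
    refine mem_biUnion.2 ⟨s 0, mem_univ _, mem_image.2 ⟨Fin.tail s, ?_, Fin.cons_self_tail s⟩⟩
    refine Fintype.mem_piFinset.2 fun k => mem_filter.2 ⟨mem_univ _, ?_⟩
    exact (hs' 0 k.succ (Fin.succ_ne_zero k).symm).2
  have hcard : #({s : Fin (p + 1) → Fin n → Bool | ∀ k l, k ≠ l →
      (hammingDist (s k) (s l) : ℝ) ∈ Set.Icc a (β * n)} : Finset _) ≤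
      ∑ σ₀ : Fin n → Bool, #(ball σ₀) ^ p := by
    refine (card_le_card hsub).trans (card_biUnion_le.trans (sum_le_sum fun σ₀ _ => ?_))
    refine card_image_le.trans (le_of_eq ?_)
    rw [Fintype.card_piFinset]
    simp
  calc _ ≤ ∑ σ₀ : Fin n → Bool, (#(ball σ₀) : ℝ) ^ p := by exact_mod_cast hcard
    _ ≤ ∑ _σ₀ : Fin n → Bool, Real.exp (n * (β * (1 - Real.log β))) ^ p := by
        gcongr with σ₀
        exact card_hammingBall_le σ₀ hβ hβ1
    _ = _ := by
        rw [sum_const, card_univ, Fintype.card_fun, Fintype.card_bool, Fintype.card_fin,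
          nsmul_eq_mul, ← Real.exp_nat_mul, mul_add, Real.exp_add, Real.exp_nat_mul (Real.log 2),
          Real.exp_log two_pos]
        push_cast
        congr 2
        ring

open Classical in
/-- First moment bound for tuples of satisfying assignments with pairwise distances in
`[β₀ n, β n]`. -/
theorem expect_exists_tuple_le {p : ℕ} (hK0 : K ≠ 0) (hK : K ≤ n) {β₀ β : ℝ}
    (hβ : 0 < β) (hβ1 : β ≤ 1) (h₀ : (1 - β₀) ^ K ≤ 1 / K) (h₁ : β ^ K ≤ 1 / K) :
    𝔼 Φ : Formula K n m, (if ∃ s : Fin (p + 1) → Fin n → Bool, (∀ k, Φ.IsSatisfiedBy (s k)) ∧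
      ∀ k l, k ≠ l → (hammingDist (s k) (s l) : ℝ) ∈ Set.Icc (β₀ * n) (β * n) then (1 : ℝ) else 0)
      ≤ Real.exp (n * (Real.log 2 + p * (β * (1 - Real.log β)))
        - m * (2 / 2 ^ K * ((p + 1 : ℕ) - ((p + 1 : ℕ) : ℝ) ^ 2 / K))) := by
  have := Clause.nonempty hK
  have hn : (0 : ℝ) < n := by
    have : 0 < n := by omega
    exact_mod_cast this
  set v : ℝ := 2 / 2 ^ K * ((p + 1 : ℕ) - ((p + 1 : ℕ) : ℝ) ^ 2 / K)
  let 𝒯 : Finset (Fin (p + 1) → Fin n → Bool) := {s | ∀ k l, k ≠ l →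
      (hammingDist (s k) (s l) : ℝ) ∈ Set.Icc (β₀ * n) (β * n)}
  have hone : ∀ s ∈ 𝒯, 𝔼 Φ : Formula K n m,
      (if ∀ k, Φ.IsSatisfiedBy (s k) then (1 : ℝ) else 0) ≤ Real.exp (-v) ^ m := by
    intro s hs
    have hprod : ∀ Φ : Formula K n m, (if ∀ k, Φ.IsSatisfiedBy (s k) then (1 : ℝ) else 0)
        = ∏ j ∈ (univ : Finset (Fin m)), if ∀ k, (Φ j).IsSatisfiedBy (s k) then (1 : ℝ) else 0 := by
      intro Φ
      by_cases h : ∀ k, Φ.IsSatisfiedBy (s k)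
      · rw [if_pos h]
        exact (prod_eq_one fun j _ => if_pos fun k => h k j).symm
      · rw [if_neg h]
        push Not at h
        obtain ⟨k, hk⟩ := h
        obtain ⟨j, hj⟩ := not_forall.1 hk
        exact (prod_eq_zero (mem_univ j) (if_neg fun h' => hj (h' k))).symm
    simp_rw [hprod]
    rw [expect_prod_eq_prod_expect univ fun C : Clause K n =>
      if ∀ k, C.IsSatisfiedBy (s k) then (1 : ℝ) else 0, card_univ, Fintype.card_fin]
    refine pow_le_pow_left₀ (expect_nonneg fun C _ => by positivity) ?_ m
    refine (expect_forall_isSatisfiedBy_le hK0 hK s fun k l hkl => ?_).trans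
      (by linarith [Real.add_one_le_exp (-v)])
    obtain ⟨h₂, h₃⟩ := (mem_filter.1 hs).2 k l hkl
    have h₄ : (hammingDist (s k) (s l) : ℝ) / n ≤ β := (div_le_iff₀ hn).2 h₃
    have h₅ : β₀ ≤ (hammingDist (s k) (s l) : ℝ) / n := (le_div_iff₀ hn).2 h₂
    have h₆ : ((hammingDist (s k) (s l) : ℝ) / n) ^ K ≤ β ^ K := by gcongr
    have h₇ : (1 - (hammingDist (s k) (s l) : ℝ) / n) ^ K ≤ (1 - β₀) ^ K := by
      refine pow_le_pow_left₀ (by linarith) (by linarith) K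
    have : (2 : ℝ) / K = 1 / K + 1 / K := by ring
    linarith
  calc _ ≤ 𝔼 Φ : Formula K n m, ∑ s ∈ 𝒯, (if ∀ k, Φ.IsSatisfiedBy (s k) then (1 : ℝ) else 0) := by
        refine expect_le_expect fun Φ _ => ?_
        have h0 : ∀ s : Fin (p + 1) → Fin n → Bool,
            (0 : ℝ) ≤ if ∀ k, Φ.IsSatisfiedBy (s k) then (1 : ℝ) else 0 :=
          fun s => by positivity
        split_ifs with h
        · obtain ⟨s, hs, hs'⟩ := h
          refine le_trans ?_ (single_le_sum (f := fun s : Fin (p + 1) → Fin n → Bool =>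
            if ∀ k, Φ.IsSatisfiedBy (s k) then (1 : ℝ) else 0) (fun s _ => h0 s)
              (mem_filter.2 ⟨mem_univ s, hs'⟩))
          simp [hs]
        · exact sum_nonneg fun s _ => h0 s
    _ ≤ #𝒯 * Real.exp (-v) ^ m := by
        rw [expect_sum_comm, ← nsmul_eq_mul]
        exact sum_le_card_nsmul _ _ _ hone
    _ ≤ Real.exp (n * (Real.log 2 + p * (β * (1 - Real.log β)))) * Real.exp (-v) ^ m := by
        gcongr
        exact card_tuples_le hβ hβ1
    _ = _ := by
        rw [← Real.exp_nat_mul, ← Real.exp_add]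
        congr 1
        ring

/-! ### The choice of the parameters -/

/-- With distances around `(log K / K) n` and `q` of order `K / log² K`, the entropy of the
tuples is smaller than the price of satisfying all clauses. -/
theorem exists_parameters {ε : ℝ} (hε : 0 < ε) : ∃ K₀ : ℕ, ∀ K : ℕ, K₀ ≤ K →
    K ≠ 0 ∧ 0 < Real.log K ∧ (Real.log K + 1) / K ≤ 1 / 2 ∧ (1 - Real.log K / K) ^ K ≤ 1 / (K : ℝ) ∧
    ((Real.log K + 1) / K) ^ K ≤ 1 / (K : ℝ) ∧ ∃ p : ℕ, 1 ≤ p ∧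
      0 < 2 / 2 ^ K * ((p + 1 : ℕ) - ((p + 1 : ℕ) : ℝ) ^ 2 / K) ∧
      ∀ d : ℝ, (1 + ε) * (2 : ℝ) ^ (K - 1) * (Real.log K) ^ 2 / K < d →
        Real.log 2 + p * ((Real.log K + 1) / K * (1 - Real.log ((Real.log K + 1) / K))) <
          d * (2 / 2 ^ K * ((p + 1 : ℕ) - ((p + 1 : ℕ) : ℝ) ^ 2 / K)) := by
  have hlog : Filter.Tendsto (fun K : ℕ => Real.log K) Filter.atTop Filter.atTop :=
    Real.tendsto_log_atTop.comp tendsto_natCast_atTop_atTop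
  have hinv : Filter.Tendsto (fun K : ℕ => ((K : ℝ))⁻¹) Filter.atTop (nhds 0) :=
    tendsto_inv_atTop_zero.comp tendsto_natCast_atTop_atTop
  have hloginv : Filter.Tendsto (fun K : ℕ => (Real.log K)⁻¹) Filter.atTop (nhds 0) :=
    tendsto_inv_atTop_zero.comp hlog
  have hdiv : Filter.Tendsto (fun K : ℕ => Real.log K * (K : ℝ)⁻¹) Filter.atTop (nhds 0) := by
    have h := Real.isLittleO_log_id_atTop.tendsto_div_nhds_zero.comp
      (tendsto_natCast_atTop_atTop (R := ℝ))
    simpa [div_eq_mul_inv, Function.comp_def] using h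
  have h₁ : ∀ᶠ K : ℕ in Filter.atTop, (Real.log K + 1) / K ≤ 1 / 2 := by
    have h := hdiv.add hinv
    rw [add_zero] at h
    filter_upwards [h.eventually (ge_mem_nhds (by norm_num : (0 : ℝ) < 1 / 2))] with K hK
    rwa [div_eq_mul_inv, add_mul, one_mul]
  have h₂ : ∀ᶠ K : ℕ in Filter.atTop,
      (1 + ε) * (2 / ε * ((Real.log K)⁻¹ * (Real.log K)⁻¹) + 3 * (K : ℝ)⁻¹) + (Real.log K)⁻¹
        ≤ ε / 2 := by
    have h := ((((hloginv.mul hloginv).const_mul (2 / ε)).add (hinv.const_mul 3)).const_mul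
      (1 + ε)).add hloginv
    simp only [mul_zero, add_zero] at h
    exact h.eventually (ge_mem_nhds (by positivity))
  obtain ⟨K₀, hK₀⟩ := Filter.eventually_atTop.1 ((h₁.and h₂).and
    ((hlog.eventually_ge_atTop 2).and (Filter.eventually_ge_atTop 1)))
  refine ⟨K₀, fun K hK => ?_⟩
  obtain ⟨⟨hβ, hq⟩, hL, hK1⟩ := hK₀ K hK
  set L := Real.log K
  have hKpos : (0 : ℝ) < K := by exact_mod_cast hK1
  have hL0 : 0 < L := by linarith
  have hexp : Real.exp (-L) = 1 / K := by
    rw [Real.exp_neg, Real.exp_log hKpos, one_div]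
  have hLK : L / K ≤ 1 := by
    have : L / K ≤ (L + 1) / K := by gcongr; linarith
    linarith
  refine ⟨by omega, hL0, hβ, ?_, ?_, ?_⟩
  · rw [← hexp]
    calc (1 - L / K) ^ K ≤ Real.exp (-(L / K)) ^ K := by
          refine pow_le_pow_left₀ (by linarith) (by linarith [Real.add_one_le_exp (-(L / K))]) K
      _ = Real.exp (-L) := by
          rw [← Real.exp_nat_mul]
          congr 1
          field_simp
  · calc ((L + 1) / K) ^ K ≤ (1 / 2) ^ K := by gcongr
      _ ≤ 1 / K := by
        rw [div_pow, one_pow]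
        refine one_div_le_one_div_of_le hKpos ?_
        exact_mod_cast Nat.lt_two_pow_self.le
  · -- With `2 K / (ε log² K)` assignments the excess of the cost of the clauses over the entropy
    -- of the other assignments exceeds the entropy `log 2` of the first assignment.
    set c := ⌈2 / ε * (K * (L⁻¹ * L⁻¹))⌉₊
    refine ⟨c + 1, by omega, ?_⟩
    set q : ℝ := ((c + 1 + 1 : ℕ) : ℝ)
    have hpq : (((c + 1 : ℕ) : ℕ) : ℝ) ≤ q := by
      simp only [q]
      push_cast
      linarith
    have hq_low : 2 / ε * (K * (L⁻¹ * L⁻¹)) ≤ q := by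
      have := Nat.le_ceil (2 / ε * (K * (L⁻¹ * L⁻¹)))
      simp only [q]
      push_cast
      linarith
    have hq_up : q ≤ 2 / ε * (K * (L⁻¹ * L⁻¹)) + 3 := by
      have := Nat.ceil_lt_add_one (a := 2 / ε * (K * (L⁻¹ * L⁻¹))) (by positivity)
      simp only [q]
      push_cast
      linarith
    have hq0 : 0 < q := by positivity
    have hqK : q / K ≤ 2 / ε * (L⁻¹ * L⁻¹) + 3 * (K : ℝ)⁻¹ := by
      calc q / K ≤ (2 / ε * (K * (L⁻¹ * L⁻¹)) + 3) / K := by gcongr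
        _ = _ := by field_simp
    have hkey : ε / 2 ≤ (1 + ε) * (1 - q / K) - 1 - L⁻¹ := by
      have : (1 + ε) * (q / K) ≤ (1 + ε) * (2 / ε * (L⁻¹ * L⁻¹) + 3 * (K : ℝ)⁻¹) := by gcongr
      linarith
    have hinvL : 0 < L⁻¹ := by positivity
    have hpos : 0 < 1 - q / K := by
      by_contra hcon
      have : (1 + ε) * (1 - q / K) ≤ 0 :=
        mul_nonpos_of_nonneg_of_nonpos (by linarith) (not_lt.1 hcon)
      linarith
    have hv : q - q ^ 2 / K = q * (1 - q / K) := by ring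
    rw [hv]
    refine ⟨by positivity, fun d hd => ?_⟩
    have hent : (L + 1) / K * (1 - Real.log ((L + 1) / K)) ≤ (L + 1) * L / K := by
      have h1 : 1 ≤ Real.log (L + 1) := by
        rw [Real.le_log_iff_exp_le (by linarith)]
        linarith [Real.exp_one_lt_d9]
      rw [Real.log_div (by linarith) hKpos.ne']
      change (L + 1) / K * (1 - (Real.log (L + 1) - L)) ≤ _
      rw [mul_div_right_comm]
      gcongr
      linarith
    have hent0 : 0 ≤ (L + 1) * L / K := by positivity
    have hmain : 1 ≤ q * L ^ 2 / K * ((1 + ε) * (1 - q / K) - 1 - L⁻¹) := by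
      calc (1 : ℝ) = (2 / ε * (K * (L⁻¹ * L⁻¹))) * L ^ 2 / K * (ε / 2) := by field_simp
        _ ≤ _ := by gcongr
    have hpow : (2 : ℝ) / 2 ^ K * 2 ^ (K - 1) = 1 := by
      obtain ⟨j, rfl⟩ := Nat.exists_eq_succ_of_ne_zero (by omega : K ≠ 0)
      rw [Nat.succ_sub_one, pow_succ]
      field_simp
    calc _ ≤ Real.log 2 + q * ((L + 1) * L / K) := by
          refine add_le_add_right ((mul_le_mul_of_nonneg_left hent (Nat.cast_nonneg _)).trans ?_) _
          gcongr
      _ < 1 + q * ((L + 1) * L / K) := by linarith [Real.log_two_lt_d9]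
      _ ≤ q * L ^ 2 / K * ((1 + ε) * (1 - q / K) - 1 - L⁻¹) + q * ((L + 1) * L / K) := by
          linarith
      _ = (2 / 2 ^ K * 2 ^ (K - 1)) * ((1 + ε) * L ^ 2 / K * (q * (1 - q / K))) := by
          rw [hpow]
          field_simp
          ring
      _ = (1 + ε) * 2 ^ (K - 1) * L ^ 2 / K * (2 / 2 ^ K * (q * (1 - q / K))) := by ring
      _ ≤ _ := by gcongr

/-! ### The success probability -/

theorem successProb_eq (hK : K ≤ n) (hr : Even r) (τ : LocalRule K r) :
    successProb hr τ n m = ENNReal.ofReal (𝔼 Φ : Formula K n m,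
      (volume {u | Φ.IsSatisfiedBy (output hr τ Φ.toInstance u)}).toReal) := by
  classical
  have := Clause.nonempty hK
  have hdisc : DiscreteMeasurableSpace (Clause K n) := ⟨fun _ => trivial⟩
  have hsing : ∀ Φ : Formula K n m, randomFormula K n m {Φ}
      = (Fintype.card (Formula K n m) : ENNReal)⁻¹ := by
    intro Φ
    rw [randomFormula, Measure.pi_singleton]
    have : ∀ C : Clause K n, uniformOn (Set.univ : Set (Clause K n)) {C}
        = (Fintype.card (Clause K n) : ENNReal)⁻¹ := by
      intro C
      rw [uniformOn_univ, Measure.count_singleton, one_div]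
    simp only [this, prod_const, card_univ, Fintype.card_fin, Fintype.card_fun]
    push_cast
    rw [ENNReal.inv_pow]
  have hmeas : MeasurableSet {ω : Formula K n m × (Fin n → unitInterval) |
      Formula.IsSatisfiedBy ω.1 (output hr τ (Formula.toInstance ω.1) ω.2)} := by
    have : {ω : Formula K n m × (Fin n → unitInterval) |
        Formula.IsSatisfiedBy ω.1 (output hr τ (Formula.toInstance ω.1) ω.2)} =
        ⋃ Φ : Formula K n m, {Φ} ×ˢ ((fun u => output hr τ Φ.toInstance u) ⁻¹'
          {σ | Φ.IsSatisfiedBy σ}) := by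
      ext ⟨Φ, u⟩
      simp
    rw [this]
    exact MeasurableSet.iUnion fun Φ => (measurableSet_singleton Φ).prod
      (measurable_output hr τ Φ (Set.toFinite _).measurableSet)
  rw [successProb, Measure.prod_apply hmeas, lintegral_fintype, Fintype.expect_eq_sum_div_card,
    ENNReal.ofReal_div_of_pos (by exact_mod_cast Fintype.card_pos), ENNReal.ofReal_natCast,
    ENNReal.ofReal_sum_of_nonneg fun _ _ => ENNReal.toReal_nonneg, div_eq_mul_inv, sum_mul]
  refine sum_congr rfl fun Φ _ => ?_
  rw [hsing, ENNReal.ofReal_toReal (measure_ne_top _ _)]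
  rfl

/-- For fixed `K` and `d`, the algorithm fails once the first moment of the tuples of satisfying
assignments at distances around `(log K / K) n` decays exponentially. -/
theorem tendsto_successProb {d : ℝ} (hd0 : 0 ≤ d) (hr : Even r) {τ : LocalRule K r}
    (hτ : τ.IsBalanced) (hKne : K ≠ 0) (hL : 0 < Real.log K)
    (hβ : (Real.log K + 1) / K ≤ 1 / 2) (h₀ : (1 - Real.log K / K) ^ K ≤ 1 / (K : ℝ))
    (h₁ : ((Real.log K + 1) / K) ^ K ≤ 1 / (K : ℝ)) {p : ℕ} (hp : 1 ≤ p)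
    (hv : 0 < 2 / 2 ^ K * ((p + 1 : ℕ) - ((p + 1 : ℕ) : ℝ) ^ 2 / K))
    (hent : Real.log 2 + p * ((Real.log K + 1) / K * (1 - Real.log ((Real.log K + 1) / K))) <
      d * (2 / 2 ^ K * ((p + 1 : ℕ) - ((p + 1 : ℕ) : ℝ) ^ 2 / K))) :
    Filter.Tendsto (fun n : ℕ => successProb hr τ n ⌊d * (n : ℝ)⌋₊) Filter.atTop (nhds 0) := by
  classical
  have hKpos : (0 : ℝ) < K := by
    have := Nat.pos_of_ne_zero hKne
    exact_mod_cast this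
  set β₀ := Real.log K / K
  set β := (Real.log K + 1) / K
  set v := 2 / 2 ^ K * ((p + 1 : ℕ) - ((p + 1 : ℕ) : ℝ) ^ 2 / K)
  set h := Real.log 2 + p * (β * (1 - Real.log β))
  have hβpos : 0 < β := by positivity
  have hβ₀ : 0 ≤ β₀ := by positivity
  have hgap : β - β₀ = 1 / K := by
    simp only [β, β₀]
    ring
  have hgap0 : (0 : ℝ) < 1 / K := by positivity
  rw [ENNReal.tendsto_nhds_zero]
  intro η' hη'
  obtain ⟨η, hη, hηη'⟩ : ∃ η : ℝ, 0 < η ∧ ENNReal.ofReal (3 * η) ≤ η' := by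
    rcases eq_or_ne η' ⊤ with rfl | htop
    · exact ⟨1, one_pos, le_top⟩
    · refine ⟨η'.toReal / 3, by have := ENNReal.toReal_pos hη'.ne' htop; positivity, ?_⟩
      rw [mul_div_cancel₀ _ (by norm_num : (3 : ℝ) ≠ 0), ENNReal.ofReal_toReal htop]
  -- The admissible proportion `δ` of correlated pairs.
  obtain ⟨δ, hδ, hδ₁, hδ₂⟩ : ∃ δ : ℝ, 0 < δ ∧
      ((p + 1 : ℕ) : ℝ) ^ 2 * (δ / (1 / K / 4) ^ 2) ≤ η ^ (p + 1) ∧ 2 * √δ ≤ 1 / K / 4 := by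
    have h1 : Filter.Tendsto (fun δ : ℝ => ((p + 1 : ℕ) : ℝ) ^ 2 * (δ / (1 / K / 4) ^ 2))
        (nhdsWithin 0 (Set.Ioi 0)) (nhds (((p + 1 : ℕ) : ℝ) ^ 2 * (0 / (1 / K / 4) ^ 2))) :=
      (Continuous.tendsto (by fun_prop) 0).mono_left nhdsWithin_le_nhds
    have h2 : Filter.Tendsto (fun δ : ℝ => 2 * √δ) (nhdsWithin 0 (Set.Ioi 0))
        (nhds (2 * √0)) := (Continuous.tendsto (by fun_prop) 0).mono_left nhdsWithin_le_nhds
    rw [zero_div, mul_zero] at h1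
    rw [Real.sqrt_zero, mul_zero] at h2
    obtain ⟨δ, ⟨h3, h4⟩, h5⟩ := ((h1.eventually (ge_mem_nhds (by positivity :
      (0 : ℝ) < η ^ (p + 1)))).and (h2.eventually (ge_mem_nhds (by positivity :
      (0 : ℝ) < 1 / K / 4)))).and self_mem_nhdsWithin |>.exists
    exact ⟨δ, h5, h3, h4⟩
  obtain ⟨N, hN⟩ := exists_expect_card_correlatedPairs_le K r hd0 (mul_pos hδ hη)
  have hfirst : ∀ᶠ n : ℕ in Filter.atTop, Real.exp (n * h - ⌊d * (n : ℝ)⌋₊ * v) ≤ η := by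
    have hlim : Filter.Tendsto (fun n : ℕ => Real.exp (n * (h - d * v) + v))
        Filter.atTop (nhds 0) := by
      refine Real.tendsto_exp_atBot.comp (Filter.tendsto_atBot_add_const_right _ _ ?_)
      exact tendsto_natCast_atTop_atTop.atTop_mul_const_of_neg (by linarith)
    filter_upwards [hlim.eventually (ge_mem_nhds hη)] with n hn
    refine le_trans (Real.exp_le_exp.2 ?_) hn
    have := Nat.lt_floor_add_one (d * (n : ℝ))
    nlinarith
  filter_upwards [hfirst, Filter.eventually_ge_atTop N, Filter.eventually_ge_atTop K,
    Filter.eventually_ge_atTop 1] with n hn₁ hnN hnK hn1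
  have hnpos : (0 : ℝ) < n := by exact_mod_cast hn1
  set m := ⌊d * (n : ℝ)⌋₊
  have hm : (m : ℝ) ≤ d * n := Nat.floor_le (by positivity)
  rw [successProb_eq hnK]
  refine le_trans (ENNReal.ofReal_le_ofReal ?_) hηη'
  have hne := Clause.nonempty hnK
  let g : Formula K n m → ℝ := fun Φ =>
    (MeasureTheory.volume {u | Φ.IsSatisfiedBy (output hr τ Φ.toInstance u)}).toReal
  let T : Formula K n m → Prop := fun Φ => ∃ s : Fin (p + 1) → Fin n → Bool,
    (∀ k, Φ.IsSatisfiedBy (s k)) ∧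
      ∀ k l, k ≠ l → (hammingDist (s k) (s l) : ℝ) ∈ Set.Icc (β₀ * n) (β * n)
  have hg1 : ∀ Φ, g Φ ≤ 1 := fun Φ => MeasureTheory.measureReal_le_one
  have hpt : ∀ Φ, g Φ ≤ (if T Φ then 1 else 0) + #(correlatedPairs Φ r) / (δ * n ^ 2) + η := by
    intro Φ
    have hfrac : 0 ≤ (#(correlatedPairs Φ r) : ℝ) / (δ * n ^ 2) := by positivity
    by_cases hT : T Φ
    · rw [if_pos hT]
      linarith [hg1 Φ]
    rw [if_neg hT]
    by_cases hP : δ * (n : ℝ) ^ 2 < #(correlatedPairs Φ r)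
    · have : 1 ≤ (#(correlatedPairs Φ r) : ℝ) / (δ * n ^ 2) :=
        (one_le_div (by positivity)).2 hP.le
      linarith [hg1 Φ]
    · rw [not_lt] at hP
      have hwidth : β * n - β₀ * n = 1 / K * n := by rw [← sub_mul, hgap]
      have hpow := pow_volume_isSatisfiedBy_le hr hτ Φ (q := p + 1) (by omega)
        (a := β₀ * n) (b := β * n) (by positivity) (by
          have : 0 < 1 / (K : ℝ) * n := by positivity
          linarith) (by
          have : β₀ ≤ 1 / 2 := by linarith
          nlinarith) (by
          intro s hs
          by_contra hcon
          push Not at hcon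
          exact hT ⟨s, hs, hcon⟩) (by
          rw [hwidth]
          calc 2 * √(#(correlatedPairs Φ r) : ℝ) ≤ 2 * √(δ * n ^ 2) := by gcongr
            _ = 2 * √δ * n := by
              rw [Real.sqrt_mul hδ.le, Real.sqrt_sq hnpos.le, mul_assoc]
            _ ≤ 1 / K / 4 * n := by gcongr
            _ = _ := by ring)
      have hpow' : g Φ ^ (p + 1) ≤ η ^ (p + 1) := by
        have h2 := ENNReal.toReal_mono ENNReal.ofReal_ne_top hpow
        rw [ENNReal.toReal_pow, ENNReal.toReal_ofReal (by positivity)] at h2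
        refine h2.trans (le_trans ?_ hδ₁)
        rw [hwidth]
        have e : δ / (1 / K / 4 : ℝ) ^ 2 = δ * n ^ 2 / (1 / K * n / 4) ^ 2 := by
          field_simp
        rw [e]
        gcongr
      have := le_of_pow_le_pow_left₀ (Nat.succ_ne_zero p) hη.le hpow'
      linarith
  calc 𝔼 Φ, g Φ ≤ 𝔼 Φ : Formula K n m,
        ((if T Φ then 1 else 0) + #(correlatedPairs Φ r) / (δ * n ^ 2) + η) :=
        expect_le_expect fun Φ _ => hpt Φ
    _ = 𝔼 Φ : Formula K n m, (if T Φ then (1 : ℝ) else 0)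
        + (𝔼 Φ : Formula K n m, (#(correlatedPairs Φ r) : ℝ)) / (δ * n ^ 2) + η := by
        rw [expect_add_distrib, expect_add_distrib, Fintype.expect_const, expect_div]
    _ ≤ η + η + η := by
        gcongr
        · refine le_trans ?_ hn₁
          convert expect_exists_tuple_le (p := p) hKne hnK hβpos (by linarith) h₀ h₁ using 1
        · rw [div_le_iff₀ (by positivity)]
          refine (hN n m hnN hnK hm).trans (le_of_eq ?_)
          ring
    _ = 3 * η := by ring

end NAESAT

theorem mainTheorem1 (ε : ℝ) (hε : 0 < ε) :
    ∃ K₀ : ℕ, ∀ K : ℕ, K₀ ≤ K → ∀ d : ℝ,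
      (1 + ε) * (2 : ℝ) ^ (K - 1) * (Real.log K) ^ 2 / K < d →
      ∀ (r : ℕ) (hr : Even r), 0 < r →
      ∀ τ : NAESAT.LocalRule K r, τ.IsBalanced →
        Filter.Tendsto (fun n : ℕ => NAESAT.successProb hr τ n ⌊d * (n : ℝ)⌋₊)
          Filter.atTop (nhds 0) := by
  obtain ⟨K₀, hK₀⟩ := NAESAT.exists_parameters hε
  refine ⟨K₀, fun K hK d hd r hr _ τ hτ => ?_⟩
  obtain ⟨hKne, hL, hβ, h₀, h₁, p, hp, hv, hent⟩ := hK₀ K hK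
  exact NAESAT.tendsto_successProb (le_trans (by positivity) hd.le) hr hτ hKne hL hβ h₀ h₁ hp hv
    (hent d hd)
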